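/- **Theorem 1.4.** Setting and notation. Let $d\ge 1$ be an integer and $C\ge 1$. Let $H$ be a real separable Hilbert space, possibly infinite dimensional, with $d<\dim H$. Let $B(x,t)$ denote the closed ball, and write $3B=B(z,3r)$ if $B=B(z,r)$. A locally finite Borel measure $\mu$ on $H$ is *$d$-regular with constant $C$* if $C^{-1}t^d\le\mu(B(x,t))\le C\,t^d$ for all $x\in\operatorname{supp}\mu$ and all real $t$ with $0<t\le\operatorname{diam}(\operatorname{supp}\mu)$ (the diameter may be infinite). In particular, if $\mu$ is $d$-regular, then $C$ may be taken to be its regularity constant $C_\mu$, the smallest admissible one. For $X=(x_0,\dots,x_{d+1})\in H^{d+2}$ let $\min(X)$ and $\operatorname{diam}(X)$ be the smallest and the largest of the edge lengths $\|x_i-x_j\|$, $i\ne j$. Let $\mathrm M_{d+1}(X)$ be the $(d+1)$-volume of the parallelotope spanned by $x_1-x_0,\dots,x_{d+1}-x_0$, and put $$\mathrm{p}_d\mathrm{sin}_{x_i}(X)=\frac{\mathrm M_{d+1}(X)}{\prod_{j\ne i}\|x_j-x_i\|},\qquad c_{\mathrm{MT}}(X)=\sqrt{\frac1{d+2}\cdot\frac1{\operatorname{diam}(X)^{d(d+1)}}\sum_{i=0}^{d+1}\mathrm{p}_d\mathrm{sin}^2_{x_i}(X)},$$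 each being $0$ if its denominator is $0$. For $\lambda>0$ and $A\subseteq H$ define $$c_{\mathrm{MT}}^2(x,t,\lambda)=\int_{\{X\in B(x,t)^{d+2}:\ \min(X)\ge\lambda t\}}c_{\mathrm{MT}}^2(X)\,d\mu^{d+2}(X),$$ $$c_{\mathrm{MT}}^2(\mu|_A,\lambda)=\int_{\{X\in A^{d+2}:\ \min(X)\ge\lambda\operatorname{diam}(X)>0\}}c_{\mathrm{MT}}^2(X)\,d\mu^{d+2}(X).$$ Let $$\beta_2(x,t)=\Big(\inf_{L}\int_{B(x,t)}\Big(\frac{\operatorname{dist}(y,L)}{2t}\Big)^2\frac{d\mu(y)}{\mu(B(x,t))}\Big)^{1/2},$$ where $L$ runs over all $d$-dimensional affine subspaces of $H$ (and $\beta_2(x,t)=0$ if $\mu(B(x,t))=0$), and for a ball $B$ let $$J_2(\mu|_B)=\int_B\int_0^{\operatorname{diam}(B)}\beta_2^2(x,t)\,\frac{dt}{t}\,d\mu(x).$$ Claim. There are constants $0<\lambda_0<2$, $C_1\ge1$ and $C_3\ge1$, depending only on $d$ and $C$, such that for every $H$ as above and every $\mu$ on $H$ that is $d$-regular with constant $C$: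 1. ($\lambda_0$ is a constant for the single-scale estimate) $\ \beta_2^2(x,t)\cdot\mu(B(x,t))\le C_1\cdot c_{\mathrm{MT}}^2(x,t,\lambda_0)$ for all $x\in\operatorname{supp}\mu$ and $0<t\le\operatorname{diam}(\operatorname{supp}\mu)$; 2. with the same $\lambda_0$, $\ J_2(\mu|_B)\le C_3\cdot c_{\mathrm{MT}}^2(\mu|_{3B},\lambda_0/2)$ for every closed ball $B\subseteq H$ of positive radius with $\operatorname{diam}(B)\le\operatorname{diam}(\operatorname{supp}\mu)$. Both inequalities are between values in $[0,\infty]$. -/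

import Mathlib

open MeasureTheory
open scoped ENNReal

noncomputable section

namespace MengerCurvature

variable {H : Type*} [NormedAddCommGroup H] [InnerProductSpace ℝ H]

/-! ### Simplices, represented by their tuples of vertices -/

/-- The smallest edge length `min(X)` of the simplex with vertices `X 0, …, X (d+1)`. -/
def minEdge {d : ℕ} (X : Fin (d + 2) → H) : ℝ :=
  ⨅ p : {p : Fin (d + 2) × Fin (d + 2) // p.1 ≠ p.2}, dist (X p.1.1) (X p.1.2)

/-- The largest edge length `diam(X)`, i.e. the diameter of the (finite) set of vertices. -/
def simplexDiam {d : ℕ} (X : Fin (d + 2) → H) : ℝ :=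
  Metric.diam (Set.range X)

/-- The content `M_{d+1}(X)`: the `(d+1)`-dimensional volume of the parallelotope spanned by the
edge vectors `X i - X 0`, `1 ≤ i ≤ d + 1`, as the square root of their Gram determinant. It equals
`(d+1)!` times the `(d+1)`-dimensional volume of the simplex. -/
def content {d : ℕ} (X : Fin (d + 2) → H) : ℝ :=
  √(Matrix.gram ℝ fun i : Fin (d + 1) => X i.succ - X 0).det

/-- The polar sine of `X` at the vertex `X i`. It is zero if the denominator is zero
(this is Lean's convention for division by zero). -/
def polarSine {d : ℕ} (X : Fin (d + 2) → H) (i : Fin (d + 2)) : ℝ :=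
  content X / ∏ j ∈ Finset.univ.erase i, ‖X j - X i‖

/-- The Menger-type curvature `c_MT(X)` of a `(d+1)`-simplex, zero if `diam(X) = 0`. -/
def cMT {d : ℕ} (X : Fin (d + 2) → H) : ℝ :=
  √(1 / ((d : ℝ) + 2) * (1 / simplexDiam X ^ (d * (d + 1))) * ∑ i, polarSine X i ^ 2)

/-- `U_λ(B(x,t))`: simplices with vertices in the closed ball `B(x,t)` and with all edges of length
at least `λ t`. -/
def bigSimplices (d : ℕ) (x : H) (t lam : ℝ) : Set (Fin (d + 2) → H) :=
  {X | (∀ i, X i ∈ Metric.closedBall x t) ∧ lam * t ≤ minEdge X}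

/-- `W_λ(A)`: well-scaled simplices with vertices in `A`. -/
def wellScaledSimplices (d : ℕ) (A : Set H) (lam : ℝ) : Set (Fin (d + 2) → H) :=
  {X | (∀ i, X i ∈ A) ∧ lam * simplexDiam X ≤ minEdge X ∧ 0 < lam * simplexDiam X}

/-- `L` is a `d`-plane: a `d`-dimensional (nonempty) affine subspace. -/
def IsPlane (d : ℕ) (L : AffineSubspace ℝ H) : Prop :=
  (L : Set H).Nonempty ∧ FiniteDimensional ℝ L.direction ∧ Module.finrank ℝ L.direction = d

/-! ### Measures -/

variable [MeasurableSpace H]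

/-- The (locally finite Borel) measure `μ` is `d`-regular with constant `C ≥ 1`:
`C⁻¹ t ^ d ≤ μ(B(x,t)) ≤ C t ^ d` for all `x ∈ supp μ` and all real `t` with
`0 < t ≤ diam(supp μ)`, where the diameter may be infinite. -/
def IsRegularWith (d : ℕ) (C : ℝ) (μ : Measure H) : Prop :=
  1 ≤ C ∧ IsLocallyFiniteMeasure μ ∧
    ∀ x ∈ μ.support, ∀ t : ℝ, 0 < t → ENNReal.ofReal t ≤ Metric.ediam μ.support →
      ENNReal.ofReal (C⁻¹ * t ^ d) ≤ μ (Metric.closedBall x t) ∧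
        μ (Metric.closedBall x t) ≤ ENNReal.ofReal (C * t ^ d)

/-- The scaled `d`-dimensional least squares error `β₂(x,t)` of `μ` at `B(x,t)` (a ball of diameter
`2t`), with the value zero if `μ(B(x,t)) = 0`. -/
def beta2 (d : ℕ) (μ : Measure H) (x : H) (t : ℝ) : ℝ≥0∞ :=
  open Classical in
  if μ (Metric.closedBall x t) = 0 then 0
  else
    (⨅ (L : AffineSubspace ℝ H) (_ : IsPlane d L),
      (∫⁻ y in Metric.closedBall x t,
        ENNReal.ofReal ((Metric.infDist y (L : Set H) / (2 * t)) ^ 2) ∂μ) /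
          μ (Metric.closedBall x t)) ^ (1 / 2 : ℝ)

/-- The Jones-type flatness
`J₂(μ|_B) = ∫_B ∫_0^{diam B} β₂(x,t)² dt/t dμ(x)` for the ball `B = B(z,r)`. -/
def jonesFlatness (d : ℕ) (μ : Measure H) (z : H) (r : ℝ) : ℝ≥0∞ :=
  ∫⁻ x in Metric.closedBall z r,
    (∫⁻ t in Set.Ioc 0 (Metric.diam (Metric.closedBall z r)),
      beta2 d μ x t ^ 2 * ENNReal.ofReal (1 / t)) ∂μ

/-- `c_MT²(x,t,λ)`: the integral of `c_MT²` over `U_λ(B(x,t))` against the product measure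
`μ^{d+2}`. -/
def localCurvature (d : ℕ) (μ : Measure H) (x : H) (t lam : ℝ) : ℝ≥0∞ :=
  ∫⁻ X in bigSimplices d x t lam, ENNReal.ofReal (cMT X ^ 2)
    ∂(Measure.pi fun _ : Fin (d + 2) => μ)

/-- `c_MT²(μ|_A, λ)`: the integral of `c_MT²` over the well-scaled simplices `W_λ(A)` against the
product measure `μ^{d+2}`. -/
def wellScaledCurvature (d : ℕ) (μ : Measure H) (A : Set H) (lam : ℝ) : ℝ≥0∞ :=
  ∫⁻ X in wellScaledSimplices d A lam, ENNReal.ofReal (cMT X ^ 2)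
    ∂(Measure.pi fun _ : Fin (d + 2) => μ)

end MengerCurvature

end

/-!
The constant `lam₀` and the single-scale estimate come from simplices in general position. In a ball
`B(x,t)` centred on the support of a `d`-regular measure, the part near a plane of dimension less than
`d` has small mass (`IsRegularWith.measure_inter_nhd_plane_le`), so one can choose in turn `d + 2`
points of the support, each far from all planes spanned by at most `d` of the preceding ones
(`IsRegularWith.exists_separated_points`). By a compactness argument on Gram matrices this persists
in balls of radius `δt` around them (`exists_separated_balls`): any simplex `X` with one vertex in
each of these balls has long edges and `d`-faces of volume at least `c t ^ d`.

Let `L` be the plane through the first `d + 1` vertices of such an `X`. A point `y ∈ B(x,t)` is close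
to at most one vertex `X i`. Exchanging that vertex for `y` gives a simplex with long edges whose
content is the volume of the `i`-th face times the distance from `y` to its plane
(`gramVolume_eq_mul_infDist`); and the plane of the `i`-th face is close to `L` in `B(x,t)` as soon as
the content of `X` itself is small (`infDist_le_of_face`). Hence `dist(y,L)²` is bounded by contents
squared of simplices with long edges (`ofReal_infDist_sq_le`), and these are bounded by `cMT²`
(`content_sq_le_mul_cMT_sq`). Integrating in `y` and averaging over `X` produces an `X` whose plane `L`
proves the estimate (`exists_plane_of_separated`, `exists_beta2_sq_mul_le`).

The multiscale estimate is the integral of the single-scale one: by Tonelli's theorem the total weight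
of a simplex `X` is at most a constant times `diam(X) ^ (-(d + 1)) * diam(X) * diam(X) ^ d = 1`, the
three factors being the density in `t`, the length of the range of `t`, and the mass of the admissible
centres `x` (`jonesFlatness_le_of_single_scale`).
-/

noncomputable section

namespace MengerCurvature

/-! ### Gram volumes and distances to planes -/

section Geometry

open Matrix Finset

variable {H : Type*} [NormedAddCommGroup H] [InnerProductSpace ℝ H]

/-- The `n`-dimensional volume of the parallelotope spanned by the edges of `z` at its first
vertex. For `n = d + 1` this is `content`. -/
def gramVolume {n : ℕ} (z : Fin (n + 1) → H) : ℝ :=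
  √(Matrix.gram ℝ fun i : Fin n => z i.succ - z 0).det

lemma gramVolume_nonneg {n : ℕ} (z : Fin (n + 1) → H) : 0 ≤ gramVolume z := Real.sqrt_nonneg _

lemma content_eq_gramVolume {d : ℕ} (X : Fin (d + 2) → H) : content X = gramVolume X := rfl

/-- Adjoining to `v` a vector whose component orthogonal to `v` is `h` multiplies the Gram determinant
by `‖h‖ ^ 2`. The vectors `v` need not be independent. -/
lemma det_gram_sumElim {n : ℕ} (v : Fin n → H) (c : Fin n → ℝ) (h : H)
    (hv : ∀ i, inner ℝ (v i) h = 0) :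
    (gram ℝ (Sum.elim v fun _ : Fin 1 => ∑ j, c j • v j + h)).det
      = (gram ℝ v).det * ‖h‖ ^ 2 := by
  have hv' : ∀ i, inner ℝ h (v i) = 0 := fun i => by rw [real_inner_comm]; exact hv i
  -- undo the contribution of `∑ j, c j • v j` by unipotent row and column operations
  have hfac : gram ℝ (Sum.elim v fun _ : Fin 1 => ∑ j, c j • v j + h) =
      fromBlocks 1 0 (of fun (_ : Fin 1) j => c j) 1 *
        fromBlocks (gram ℝ v) 0 0 (of fun (_ _ : Fin 1) => ‖h‖ ^ 2) *
        fromBlocks 1 (of fun j (_ : Fin 1) => c j) 0 1 := by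
    rw [fromBlocks_multiply, fromBlocks_multiply]
    ext (i | i) (j | j)
    · simp
    · simp [inner_add_right, inner_sum, inner_smul_right, hv, mul_apply, mul_comm]
    · simp [inner_add_left, sum_inner, inner_smul_left, hv', mul_apply]
    · obtain rfl := Subsingleton.elim i 0
      obtain rfl := Subsingleton.elim j 0
      have hs : inner ℝ (∑ j, c j • v j) h = 0 := by
        simp [sum_inner, inner_smul_left, hv]
      have hs' : inner ℝ h (∑ j, c j • v j) = 0 := by rw [real_inner_comm]; exact hs
      have : inner ℝ (∑ j, c j • v j + h) (∑ j, c j • v j + h) =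
          inner ℝ (∑ j, c j • v j) (∑ j, c j • v j) + ‖h‖ ^ 2 := by
        rw [inner_add_left, inner_add_right, inner_add_right, hs, hs',
          real_inner_self_eq_norm_sq h]
        ring
      rw [gram_apply]
      simp only [Sum.elim_inr]
      rw [this]
      simp only [sum_inner, inner_sum, inner_smul_left, inner_smul_right,
        fromBlocks_apply₂₂, Matrix.add_apply, conj_trivial]
      simp [mul_apply, mul_comm, real_inner_comm]
  rw [hfac, det_mul, det_mul, det_fromBlocks_zero₁₂, det_fromBlocks_zero₁₂, det_fromBlocks_zero₂₁]
  simp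

lemma removeNth_last_apply {α : Type*} {n : ℕ} (z : Fin (n + 1) → α) (i : Fin n) :
    (Fin.last n).removeNth z i = z i.castSucc := by
  rw [Fin.removeNth_apply, Fin.succAbove_last]

lemma range_removeNth_last {α : Type*} {n : ℕ} (z : Fin (n + 1) → α) :
    Set.range ((Fin.last n).removeNth z) = z '' {j | j < Fin.last n} := by
  ext q
  constructor
  · rintro ⟨j, rfl⟩
    exact ⟨j.castSucc, Fin.castSucc_lt_last j, (removeNth_last_apply z j).symm⟩
  · rintro ⟨j, hj, rfl⟩
    exact ⟨⟨j, hj⟩, removeNth_last_apply z _⟩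

/-- Volume is base times height: the base is spanned by all points but the last, the height is the
distance of the last point to the plane through the others. -/
lemma gramVolume_eq_mul_infDist {n : ℕ} (z : Fin (n + 2) → H) :
    gramVolume z = gramVolume ((Fin.last (n + 1)).removeNth z) *
      Metric.infDist (z (Fin.last (n + 1)))
        (affineSpan ℝ (Set.range ((Fin.last (n + 1)).removeNth z)) : Set H) := by
  set w := (Fin.last (n + 1)).removeNth z with hw
  have hwz : ∀ i, w i = z i.castSucc := removeNth_last_apply z
  set S := affineSpan ℝ (Set.range w) with hS
  have : Nonempty S := ⟨⟨w 0, subset_affineSpan _ _ ⟨0, rfl⟩⟩⟩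
  have : FiniteDimensional ℝ S.direction := by
    rw [hS, direction_affineSpan]; infer_instance
  set y := z (Fin.last (n + 1)) with hy
  set p : H := ((EuclideanGeometry.orthogonalProjection S y : S) : H) with hp
  have hpS : p ∈ S := EuclideanGeometry.orthogonalProjection_mem y
  have hw0 : w 0 ∈ S := subset_affineSpan _ _ ⟨0, rfl⟩
  have hdist : Metric.infDist y (S : Set H) = ‖y - p‖ := by
    rw [← EuclideanGeometry.dist_orthogonalProjection_eq_infDist, dist_eq_norm, norm_sub_rev]
  have hperp : ∀ v ∈ S.direction, inner ℝ v (y - p) = 0 := by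
    intro v hv
    exact (Submodule.mem_orthogonal _ _).1
      (EuclideanGeometry.vsub_orthogonalProjection_mem_direction_orthogonal S y) v hv
  have hmem : p - w 0 ∈ S.direction := AffineSubspace.vsub_mem_direction hpS hw0
  rw [hS, direction_affineSpan, vectorSpan_range_eq_span_range_vsub_right ℝ w 0,
    Submodule.mem_span_range_iff_exists_fun] at hmem
  obtain ⟨c, hc⟩ := hmem
  rw [Fin.sum_univ_succ] at hc
  simp only [vsub_eq_sub, sub_self, smul_zero, zero_add] at hc
  have key := det_gram_sumElim (fun i : Fin n => w i.succ - w 0) (fun i => c i.succ) (y - p)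
    (fun i => hperp _ (AffineSubspace.vsub_mem_direction
      (subset_affineSpan _ _ ⟨_, rfl⟩) hw0))
  rw [hc] at key
  have hre : gram ℝ (Sum.elim (fun i : Fin n => w i.succ - w 0)
      fun _ : Fin 1 => p - w 0 + (y - p)) =
      (gram ℝ fun i : Fin (n + 1) => z i.succ - z 0).submatrix finSumFinEquiv finSumFinEquiv := by
    rw [show (Sum.elim (fun i : Fin n => w i.succ - w 0)
      fun _ : Fin 1 => p - w 0 + (y - p)) =
      (fun i : Fin (n + 1) => z i.succ - z 0) ∘ finSumFinEquiv from ?_]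
    · rfl
    · funext i
      rcases i with i | i
      · simp [hwz]
        rfl
      · have : (Fin.natAdd n i).succ = Fin.last (n + 1) := by
          ext; simp
        simp [hwz, this, hy]
  rw [hre, det_submatrix_equiv_self] at key
  rw [gramVolume, key, hdist, Real.sqrt_mul (posSemidef_gram ℝ _).det_nonneg,
    Real.sqrt_sq (norm_nonneg _)]
  rfl

lemma gramVolume_le_pow {R : ℝ} : ∀ {n : ℕ} (z : Fin (n + 1) → H),
    (∀ i j, dist (z i) (z j) ≤ R) → gramVolume z ≤ R ^ n
  | 0, z, _ => by simp [gramVolume]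
  | n + 1, z, hz => by
    rw [gramVolume_eq_mul_infDist, pow_succ]
    have hR : 0 ≤ R := dist_nonneg.trans (hz 0 0)
    refine mul_le_mul (gramVolume_le_pow _ fun i j => hz _ _) ?_ Metric.infDist_nonneg (by positivity)
    exact (Metric.infDist_le_dist_of_mem
      (subset_affineSpan ℝ _ (Set.mem_range_self (0 : Fin (n + 1))))).trans (hz _ _)

/-- If every point of `z` is `a`-far from the plane through its predecessors, the volume is at least
`a ^ n`. The first point is exempt: it has no predecessors, and the distance to `∅` is `0`. -/
lemma pow_le_gramVolume {a : ℝ} (ha : 0 ≤ a) : ∀ {n : ℕ} (z : Fin (n + 1) → H),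
    (∀ k : Fin (n + 1), k ≠ 0 →
      a ≤ Metric.infDist (z k) (affineSpan ℝ (z '' {j | j < k}) : Set H)) → a ^ n ≤ gramVolume z
  | 0, z, _ => by simp [gramVolume]
  | n + 1, z, hz => by
    rw [gramVolume_eq_mul_infDist, pow_succ]
    refine mul_le_mul (pow_le_gramVolume ha _ fun k hk => ?_) ?_ ha (gramVolume_nonneg _)
    · have h := hz k.castSucc (Fin.castSucc_ne_zero_iff.2 hk)
      have hS : (Fin.last (n + 1)).removeNth z '' {j | j < k} = z '' {j | j < k.castSucc} := by
        ext q
        constructor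
        · rintro ⟨j, hj, rfl⟩
          exact ⟨j.castSucc, hj, (removeNth_last_apply z j).symm⟩
        · rintro ⟨j, hj, rfl⟩
          have hjk : j.val < k.val := hj
          exact ⟨⟨j, hjk.trans k.isLt⟩, hj, removeNth_last_apply z _⟩
      rwa [hS, removeNth_last_apply]
    · have h := hz (Fin.last (n + 1)) (by simp [Fin.ext_iff])
      rwa [range_removeNth_last]

/-- Moving the points of a tuple of diameter at most `2t` by at most `δt` does not destroy a lower
bound `c t ^ n` for its volume, and `δ` does not depend on the ambient space: the volume depends only
on the Gram matrix, which, rescaled by `t`, stays in a fixed compact set of matrices. -/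
lemma exists_gramVolume_perturb.{u} (n : ℕ) {c : ℝ} (hc : 0 < c) :
    ∃ δ : ℝ, 0 < δ ∧ ∀ (H : Type u) [NormedAddCommGroup H] [InnerProductSpace ℝ H]
      (t : ℝ) (z z' : Fin (n + 1) → H), 0 < t →
      (∀ i j, dist (z i) (z j) ≤ 2 * t) → (∀ i j, dist (z' i) (z' j) ≤ 2 * t) →
      (∀ i, dist (z i) (z' i) ≤ δ * t) → c * t ^ n ≤ gramVolume z →
      c / 2 * t ^ n ≤ gramVolume z' := by
  let K : Set (Fin n → Fin n → ℝ) := Set.univ.pi fun _ => Set.univ.pi fun _ => Set.Icc (-4) 4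
  have hK : IsCompact K := isCompact_univ_pi fun _ => isCompact_univ_pi fun _ => isCompact_Icc
  let f : (Fin n → Fin n → ℝ) → ℝ := fun M => √(of M).det
  have hf : Continuous f := by
    refine Real.continuous_sqrt.comp (Continuous.matrix_det ?_)
    exact continuous_id
  obtain ⟨η, hη, hfη⟩ := Metric.uniformContinuousOn_iff.1
    (hK.uniformContinuousOn_of_continuous hf.continuousOn) (c / 2) (by positivity)
  refine ⟨η / 16, by positivity, ?_⟩
  intro H _ _ t z z' ht hz hz' hzz hvol
  have hvolf : ∀ w : Fin (n + 1) → H,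
      gramVolume w = t ^ n * f fun i j => inner ℝ (w i.succ - w 0) (w j.succ - w 0) / t ^ 2 := by
    intro w
    have : gram ℝ (fun i : Fin n => w i.succ - w 0) = (t ^ 2) •
        (of fun i j : Fin n => inner ℝ (w i.succ - w 0) (w j.succ - w 0) / t ^ 2) := by
      ext i j
      simp [gram_apply]
      field_simp
    rw [gramVolume, this, det_smul, Fintype.card_fin, Real.sqrt_mul (by positivity), ← pow_mul,
      mul_comm 2 n, pow_mul, Real.sqrt_sq (by positivity)]
  have hmemK : ∀ w : Fin (n + 1) → H, (∀ i j, dist (w i) (w j) ≤ 2 * t) →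
      (fun i j : Fin n => inner ℝ (w i.succ - w 0) (w j.succ - w 0) / t ^ 2) ∈ K := by
    intro w hw
    simp only [K, Set.mem_univ_pi, Set.mem_Icc]
    intro i j
    rw [← abs_le, abs_div, abs_of_pos (by positivity : 0 < t ^ 2), div_le_iff₀ (by positivity)]
    refine (abs_real_inner_le_norm _ _).trans ?_
    have h1 := hw i.succ 0
    have h2 := hw j.succ 0
    rw [dist_eq_norm] at h1 h2
    calc _ ≤ (2 * t) * (2 * t) := mul_le_mul h1 h2 (norm_nonneg _) (by positivity)
      _ = _ := by ring
  have hclose : dist (fun i j : Fin n => inner ℝ (z i.succ - z 0) (z j.succ - z 0) / t ^ 2)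
      (fun i j : Fin n => inner ℝ (z' i.succ - z' 0) (z' j.succ - z' 0) / t ^ 2) < η := by
    refine lt_of_le_of_lt (b := η / 2) ?_ (by linarith)
    refine (dist_pi_le_iff (by positivity)).2 fun i => (dist_pi_le_iff (by positivity)).2 fun j => ?_
    have hd : ∀ k : Fin n, ‖(z k.succ - z 0) - (z' k.succ - z' 0)‖ ≤ η / 8 * t := by
      intro k
      have h1 := hzz k.succ
      have h2 := hzz 0
      rw [dist_eq_norm] at h1 h2
      calc _ = ‖(z k.succ - z' k.succ) - (z 0 - z' 0)‖ := by congr 1; abel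
        _ ≤ _ := norm_sub_le _ _
        _ ≤ η / 16 * t + η / 16 * t := add_le_add h1 h2
        _ = _ := by ring
    have ha := hz i.succ 0
    have hb := hz' j.succ 0
    rw [dist_eq_norm] at ha hb
    rw [Real.dist_eq, ← sub_div, abs_div, abs_of_pos (by positivity : 0 < t ^ 2),
      div_le_iff₀ (by positivity)]
    have hid : inner ℝ (z i.succ - z 0) (z j.succ - z 0) -
        inner ℝ (z' i.succ - z' 0) (z' j.succ - z' 0) =
        inner ℝ (z i.succ - z 0) ((z j.succ - z 0) - (z' j.succ - z' 0)) +
        inner ℝ ((z i.succ - z 0) - (z' i.succ - z' 0)) (z' j.succ - z' 0) := by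
      rw [inner_sub_right (z i.succ - z 0) (z j.succ - z 0), inner_sub_left (z i.succ - z 0)]; ring
    rw [hid]
    calc _ ≤ _ := abs_add_le _ _
      _ ≤ (2 * t) * (η / 8 * t) + (η / 8 * t) * (2 * t) := by
        refine add_le_add ((abs_real_inner_le_norm _ _).trans ?_)
          ((abs_real_inner_le_norm _ _).trans ?_)
        · exact mul_le_mul ha (hd j) (norm_nonneg _) (by positivity)
        · exact mul_le_mul (hd i) hb (norm_nonneg _) (by positivity)
      _ = _ := by ring
  have hlt := hfη _ (hmemK z hz) _ (hmemK z' hz') hclose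
  rw [hvolf z, mul_comm] at hvol
  have hcf := le_of_mul_le_mul_left hvol (by positivity)
  rw [hvolf z', mul_comm]
  rw [Real.dist_eq, abs_lt] at hlt
  refine mul_le_mul_of_nonneg_left ?_ (by positivity)
  linarith [hlt.2]

/-- If a point `w` lies in the affine span of a set `s ⊆ L` and one more point `q`, then its
distance to `L` is controlled by that of `q`, with the ratio of `dist w p₀` to the height of `q` over
`s` as factor. -/
lemma infDist_mul_le_of_mem_affineSpan_insert {s : Set H} {L : AffineSubspace ℝ H} {p₀ q w : H}
    (hp₀ : p₀ ∈ s) (hs : s ⊆ L) (hw : w ∈ affineSpan ℝ (insert q s)) :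
    Metric.infDist w (L : Set H) * Metric.infDist q (affineSpan ℝ s : Set H) ≤
      dist w p₀ * Metric.infDist q (L : Set H) := by
  have hp₀' : p₀ ∈ affineSpan ℝ s := subset_affineSpan ℝ s hp₀
  have hsL : affineSpan ℝ s ≤ L := affineSpan_le.2 hs
  -- `w = r (q - p₀) + p` with `p` in the span of `s`; `|r|` is the ratio of the distances of `w` and
  -- `q` to that span, up to replacing the former by `dist w p₀`
  rw [← affineSpan_insert_affineSpan, AffineSubspace.mem_affineSpan_insert_iff hp₀'] at hw
  obtain ⟨r, p, hp, rfl⟩ := hw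
  simp only [vsub_eq_sub, vadd_eq_add]
  rcases eq_or_ne r 0 with rfl | hr
  · rw [zero_smul, zero_add, Metric.infDist_zero_of_mem (hsL hp), zero_mul]
    exact mul_nonneg dist_nonneg Metric.infDist_nonneg
  have hline : ∀ (A : AffineSubspace ℝ H), p ∈ A → p₀ ∈ A → ∀ v ∈ A, ∀ a : ℝ,
      a • (v - p₀) + p ∈ A := fun A hpA hp₀A v hv a =>
    AffineSubspace.vadd_mem_of_mem_direction
      (A.direction.smul_mem a (AffineSubspace.vsub_mem_direction hv hp₀A)) hpA
  have h1 : |r| * Metric.infDist q (affineSpan ℝ s : Set H) ≤ dist (r • (q - p₀) + p) p₀ := by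
    have hmem : (-r⁻¹) • (p - p₀) + p₀ ∈ affineSpan ℝ s :=
      AffineSubspace.vadd_mem_of_mem_direction
        (Submodule.smul_mem _ _ (AffineSubspace.vsub_mem_direction hp hp₀')) hp₀'
    calc _ ≤ |r| * dist q ((-r⁻¹) • (p - p₀) + p₀) :=
          mul_le_mul_of_nonneg_left (Metric.infDist_le_dist_of_mem hmem) (abs_nonneg r)
      _ = _ := by
        rw [dist_eq_norm, dist_eq_norm, ← Real.norm_eq_abs, ← norm_smul]
        congr 1
        rw [smul_sub, smul_add, smul_smul, mul_neg, mul_inv_cancel₀ hr]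
        module
  have h2 : Metric.infDist (r • (q - p₀) + p) (L : Set H) ≤ |r| * Metric.infDist q (L : Set H) := by
    rw [← div_le_iff₀' (abs_pos.2 hr), Metric.le_infDist ⟨p₀, hs hp₀⟩]
    intro v hv
    rw [div_le_iff₀' (abs_pos.2 hr)]
    refine (Metric.infDist_le_dist_of_mem (hline L (hsL hp) (hs hp₀) v hv r)).trans_eq ?_
    rw [dist_eq_norm, dist_eq_norm, ← Real.norm_eq_abs, ← norm_smul]
    congr 1
    module
  calc _ ≤ |r| * Metric.infDist q (L : Set H) * Metric.infDist q (affineSpan ℝ s : Set H) :=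
        mul_le_mul_of_nonneg_right h2 Metric.infDist_nonneg
    _ = |r| * Metric.infDist q (affineSpan ℝ s : Set H) * Metric.infDist q (L : Set H) := by ring
    _ ≤ _ := mul_le_mul_of_nonneg_right h1 Metric.infDist_nonneg

/-- Comparison of the planes through two faces of a simplex `x`, the `i`-th one being of large volume:
the distance of `y` to the last face is at most a constant times its distance to the `i`-th face plus
the distance of the last vertex to the last face. -/
lemma infDist_le_of_face {d : ℕ} (hd : 1 ≤ d) (x : Fin (d + 2) → H) (i : Fin (d + 2)) (y : H)
    {c t : ℝ} (hc : 0 < c) (ht : 0 < t) (hx : ∀ i j, dist (x i) (x j) ≤ 2 * t)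
    (hy : ∀ j, dist y (x j) ≤ 2 * t) (hvol : c * t ^ d ≤ gramVolume (i.removeNth x)) :
    Metric.infDist y (affineSpan ℝ (Set.range ((Fin.last (d + 1)).removeNth x)) : Set H) ≤
      (1 + 2 ^ d / c) *
        (Metric.infDist y (affineSpan ℝ (Set.range (i.removeNth x)) : Set H) +
        Metric.infDist (x (Fin.last (d + 1)))
          (affineSpan ℝ (Set.range ((Fin.last (d + 1)).removeNth x)) : Set H)) := by
  set L := affineSpan ℝ (Set.range ((Fin.last (d + 1)).removeNth x)) with hL
  set D := Metric.infDist (x (Fin.last (d + 1))) (L : Set H) with hD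
  have hD0 : 0 ≤ D := Metric.infDist_nonneg
  have hK : (0 : ℝ) ≤ 2 ^ d / c := by positivity
  have hxL : ∀ j, j ≠ Fin.last (d + 1) → x j ∈ L := by
    intro j hj
    refine subset_affineSpan ℝ _ ?_
    rw [range_removeNth_last]
    exact ⟨j, Fin.lt_last_iff_ne_last.2 hj, rfl⟩
  rcases eq_or_ne i (Fin.last (d + 1)) with rfl | hi
  · have h0 : 0 ≤ Metric.infDist y (L : Set H) := Metric.infDist_nonneg
    nlinarith [mul_nonneg hK h0, mul_nonneg hK hD0]
  obtain ⟨n, rfl⟩ : ∃ n, d = n + 1 := ⟨d - 1, by omega⟩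
  set z := i.removeNth x with hz
  set b := (Fin.last (n + 1)).removeNth z with hb
  set q := x (Fin.last (n + 1 + 1)) with hq
  have hzlast : z (Fin.last (n + 1)) = q := by
    rw [hz, Fin.removeNth_apply, Fin.succAbove_ne_last_last hi]
  have hbx : ∀ j, ∃ j', j' ≠ Fin.last (n + 1 + 1) ∧ b j = x j' := by
    intro j
    refine ⟨i.succAbove j.castSucc, ?_, ?_⟩
    · exact Fin.succAbove_ne_last hi (Fin.castSucc_lt_last j).ne
    · rw [hb, removeNth_last_apply, hz, Fin.removeNth_apply]
  have hrange : Set.range z = insert q (Set.range b) := by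
    ext w
    constructor
    · rintro ⟨j, rfl⟩
      refine Fin.lastCases ?_ (fun j => ?_) j
      · exact Or.inl hzlast
      · exact Or.inr ⟨j, by rw [hb, removeNth_last_apply]⟩
    · rintro (rfl | ⟨j, rfl⟩)
      · exact ⟨_, hzlast⟩
      · exact ⟨j.castSucc, by rw [hb, removeNth_last_apply]⟩
  have hbL : Set.range b ⊆ (L : Set H) := by
    rintro _ ⟨j, rfl⟩
    obtain ⟨j', hj', h⟩ := hbx j
    rw [h]
    exact hxL j' hj'
  set e := Metric.infDist q (affineSpan ℝ (Set.range b) : Set H) with he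
  have hvb : gramVolume b ≤ (2 * t) ^ n := gramVolume_le_pow b fun j k => hx _ _
  rw [gramVolume_eq_mul_infDist, hzlast] at hvol
  have he0 : 0 ≤ e := Metric.infDist_nonneg
  -- the volume of the face bounds from below the height of the last vertex of `x` over the others
  have het : 2 * t ≤ 2 ^ (n + 1) / c * e := by
    have h1 : c * t ^ (n + 1) ≤ (2 * t) ^ n * e := hvol.trans (mul_le_mul_of_nonneg_right hvb he0)
    rw [div_mul_eq_mul_div, le_div_iff₀ hc]
    rw [mul_pow, pow_succ] at h1
    have h2 : t ^ n * (c * t) ≤ t ^ n * (2 ^ n * e) := by linarith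
    have h3 := le_of_mul_le_mul_left h2 (by positivity)
    rw [pow_succ]
    linarith
  have hepos : 0 < e := by
    rcases he0.eq_or_lt with h | h
    · rw [← h, mul_zero] at het; linarith
    · exact h
  obtain ⟨j₀, hj₀, hbj₀⟩ := hbx 0
  have hDt : D ≤ 2 * t := (Metric.infDist_le_dist_of_mem (hxL j₀ hj₀)).trans (hx _ _)
  have hmain : ∀ w ∈ affineSpan ℝ (Set.range z),
      Metric.infDist y (L : Set H) ≤ (1 + 2 ^ (n + 1) / c) * (dist y w + D) := by
    intro w hw
    rw [hrange] at hw
    have h1 := infDist_mul_le_of_mem_affineSpan_insert (Set.mem_range_self 0) hbL hw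
    rw [hbj₀] at h1
    have h2 : dist w (x j₀) ≤ dist y w + 2 * t := by
      have := dist_triangle w y (x j₀)
      rw [dist_comm w y] at this
      linarith [hy j₀]
    have h3 : Metric.infDist w (L : Set H) * e ≤ 2 ^ (n + 1) / c * (dist y w + D) * e := by
      calc _ ≤ (dist y w + 2 * t) * D := h1.trans (mul_le_mul_of_nonneg_right h2 hD0)
        _ ≤ 2 * t * (dist y w + D) := by nlinarith [dist_nonneg (x := y) (y := w)]
        _ ≤ 2 ^ (n + 1) / c * e * (dist y w + D) :=
          mul_le_mul_of_nonneg_right het (add_nonneg dist_nonneg hD0)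
        _ = _ := by ring
    have h4 := le_of_mul_le_mul_right h3 hepos
    have h5 : Metric.infDist y (L : Set H) ≤ Metric.infDist w L + dist y w :=
      Metric.infDist_le_infDist_add_dist
    linarith
  have hKpos : 0 < 1 + (2 : ℝ) ^ (n + 1) / c := by positivity
  have h6 : Metric.infDist y (L : Set H) / (1 + 2 ^ (n + 1) / c) - D ≤
      Metric.infDist y (affineSpan ℝ (Set.range z) : Set H) := by
    refine (Metric.le_infDist ⟨z 0, subset_affineSpan ℝ _ (Set.mem_range_self 0)⟩).2 ?_
    intro w hw
    have := hmain w hw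
    rw [sub_le_iff_le_add, div_le_iff₀ hKpos]
    linarith
  rw [sub_le_iff_le_add, div_le_iff₀ hKpos] at h6
  linarith

end Geometry

/-! ### Points of the support in general position -/

section Separation

variable {H : Type*} [NormedAddCommGroup H] [InnerProductSpace ℝ H]

/-- If `v` lies in a subspace with orthonormal basis `b`, its norm is at most the sum of its
coordinates in absolute value. -/
lemma norm_le_sum_abs_inner {W : Submodule ℝ H} {ι : Type*} [Fintype ι]
    (b : OrthonormalBasis ι ℝ W) (v : W) : ‖(v : H)‖ ≤ ∑ i, |inner ℝ (b i : H) (v : H)| := by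
  calc ‖(v : H)‖ = ‖v‖ := rfl
    _ = ‖∑ i, inner ℝ (b i) v • b i‖ := by rw [b.sum_repr' v]
    _ ≤ ∑ i, ‖inner ℝ (b i) v • b i‖ := norm_sum_le _ _
    _ = _ := Finset.sum_congr rfl fun i _ => by
      rw [norm_smul, b.norm_eq_one, mul_one, Real.norm_eq_abs, Submodule.coe_inner]

/-- Two points in the `ρ`-neighbourhood of a plane whose coordinates along the plane differ by at
most `ρ` are `3 (dim + 1) ρ`-close. -/
lemma dist_le_of_infDist_lt {V : AffineSubspace ℝ H} (hV : (V : Set H).Nonempty)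
    {ι : Type*} [Fintype ι] (b : OrthonormalBasis ι ℝ V.direction) {ρ : ℝ} {y y' : H}
    (hy : Metric.infDist y V < ρ) (hy' : Metric.infDist y' V < ρ)
    (hyy : ∀ i, |inner ℝ (b i : H) (y - y')| ≤ ρ) :
    dist y y' ≤ 3 * (Fintype.card ι + 1 : ℕ) * ρ := by
  obtain ⟨v, hv, hyv⟩ := (Metric.infDist_lt_iff hV).1 hy
  obtain ⟨v', hv', hyv'⟩ := (Metric.infDist_lt_iff hV).1 hy'
  rw [dist_eq_norm] at hyv hyv'
  have hρ : 0 ≤ ρ := (norm_nonneg _).trans hyv.le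
  have hmem : v - v' ∈ V.direction := AffineSubspace.vsub_mem_direction hv hv'
  have h1 : ∀ i, |inner ℝ (b i : H) (v - v')| ≤ 3 * ρ := by
    intro i
    have hb : ‖(b i : H)‖ = 1 := b.norm_eq_one i
    have e : v - v' = (y - y') - (y - v) + (y' - v') := by abel
    have h2 : |inner ℝ (b i : H) (y - v)| ≤ ρ :=
      (abs_real_inner_le_norm _ _).trans (by rw [hb, one_mul]; exact hyv.le)
    have h3 : |inner ℝ (b i : H) (y' - v')| ≤ ρ :=
      (abs_real_inner_le_norm _ _).trans (by rw [hb, one_mul]; exact hyv'.le)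
    rw [e, inner_add_right, inner_sub_right (b i : H) (y - y')]
    have h4 := hyy i
    rw [abs_le] at *
    constructor <;> linarith [h2.1, h2.2, h3.1, h3.2, h4.1, h4.2]
  have h5 : ‖v - v'‖ ≤ Fintype.card ι * (3 * ρ) := by
    refine (norm_le_sum_abs_inner b ⟨v - v', hmem⟩).trans ?_
    refine (Finset.sum_le_sum fun i _ => h1 i).trans_eq ?_
    simp
  rw [dist_eq_norm, show y - y' = (y - v) - (y' - v') + (v - v') by abel]
  refine (norm_add_le _ _).trans ((add_le_add (norm_sub_le _ _) h5).trans ?_)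
  push_cast
  nlinarith

variable [MeasurableSpace H] [SecondCountableTopology H]
  {d : ℕ} {C : ℝ} {μ : Measure H}

/-- The part of a ball near a plane of dimension less than `d` has small measure: cut it into cells
along the coordinates of the plane, there being about `m ^ (d - 1)` of them, each contained in a
ball of radius comparable with `t / m`. -/
lemma IsRegularWith.measure_inter_nhd_plane_le (hμ : IsRegularWith d C μ) (x : H) {t : ℝ}
    (ht : 0 < t) (htd : ENNReal.ofReal t ≤ Metric.ediam μ.support) {V : AffineSubspace ℝ H}
    (hV : (V : Set H).Nonempty) [FiniteDimensional ℝ V.direction]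
    (hVd : Module.finrank ℝ V.direction + 1 ≤ d) {m : ℕ} (hm : 3 * d ≤ m) :
    μ (Metric.closedBall x t ∩ {y | Metric.infDist y (V : Set H) < t / m}) ≤
      ENNReal.ofReal (C * (9 * d) ^ d / m * t ^ d) := by
  obtain ⟨hC, -, hreg⟩ := hμ
  have hd : 1 ≤ d := by omega
  have hm1 : 1 ≤ m := by omega
  have hm0 : (0 : ℝ) < m := by exact_mod_cast hm1
  set ρ := t / m with hρ
  have hρ0 : 0 < ρ := by positivity
  have htρ : t = m * ρ := by rw [hρ]; field_simp
  set N := Metric.closedBall x t ∩ {y | Metric.infDist y (V : Set H) < ρ} with hN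
  set k := Module.finrank ℝ V.direction with hk
  let b := stdOrthonormalBasis ℝ V.direction
  -- `φ y` labels the cell of `y`; coordinates are taken about `x`, as `V` need not pass near `x`
  let φ : H → Fin k → ℤ := fun y i => ⌊inner ℝ (b i : H) (y - x) / ρ⌋
  let J : Finset (Fin k → ℤ) := Fintype.piFinset fun _ => Finset.Icc (-(m : ℤ)) m
  have hcover : N ∩ μ.support ⊆ ⋃ κ ∈ J, {y | y ∈ N ∩ μ.support ∧ φ y = κ} := by
    intro y hy
    simp only [Set.mem_iUnion]
    refine ⟨φ y, ?_, hy, rfl⟩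
    rw [Fintype.mem_piFinset]
    intro i
    have h1 : |inner ℝ (b i : H) (y - x) / ρ| ≤ m := by
      rw [abs_div, abs_of_pos hρ0, div_le_iff₀ hρ0, ← htρ]
      refine (abs_real_inner_le_norm _ _).trans ?_
      have hb : ‖(b i : H)‖ = 1 := b.norm_eq_one i
      rw [hb, one_mul, ← dist_eq_norm]
      exact hy.1.1
    rw [abs_le] at h1
    rw [Finset.mem_Icc]
    constructor
    · rw [Int.le_floor]; push_cast; exact h1.1
    · have : (⌊inner ℝ (b i : H) (y - x) / ρ⌋ : ℝ) ≤ (m : ℤ) := by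
        push_cast; exact (Int.floor_le _).trans h1.2
      exact_mod_cast this
  have hdρt : 3 * d * ρ ≤ t := by
    rw [htρ]
    have : (3 * d : ℝ) ≤ m := by exact_mod_cast hm
    exact mul_le_mul_of_nonneg_right this hρ0.le
  have hcell : ∀ κ ∈ J, μ {y | y ∈ N ∩ μ.support ∧ φ y = κ} ≤
      ENNReal.ofReal (C * (3 * d * ρ) ^ d) := by
    intro κ _
    rcases Set.eq_empty_or_nonempty {y | y ∈ N ∩ μ.support ∧ φ y = κ} with h | ⟨y₀, hy₀, hφ₀⟩
    · rw [h, measure_empty]; exact zero_le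
    · have hd0 : (0 : ℝ) < d := by exact_mod_cast hd
      refine (measure_mono ?_).trans (hreg y₀ hy₀.2 (3 * d * ρ) (by positivity)
        ((ENNReal.ofReal_le_ofReal hdρt).trans htd)).2
      rintro y ⟨hy, hφ⟩
      rw [Metric.mem_closedBall]
      have hck : (Fintype.card (Fin k) + 1 : ℕ) ≤ d := by rw [Fintype.card_fin]; exact hVd
      refine (dist_le_of_infDist_lt hV b hy.1.2 hy₀.1.2 fun i => ?_).trans ?_
      · have h1 : φ y i = φ y₀ i := by rw [hφ, hφ₀]
        have h2 := Int.abs_sub_lt_one_of_floor_eq_floor h1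
        rw [← sub_div, abs_div, abs_of_pos hρ0, div_lt_one hρ0, ← inner_sub_right] at h2
        rw [show y - y₀ = y - x - (y₀ - x) by abel]
        exact h2.le
      · have : ((Fintype.card (Fin k) + 1 : ℕ) : ℝ) ≤ d := by exact_mod_cast hck
        gcongr
  have hcard : (J.card : ℝ) ≤ (3 * m) ^ (d - 1) := by
    have h1 : J.card = (2 * m + 1) ^ k := by
      simp only [J, Fintype.card_piFinset, Int.card_Icc, Finset.prod_const, Finset.card_univ,
        Fintype.card_fin]
      congr 1
      omega
    have h2 : J.card ≤ (3 * m) ^ (d - 1) := by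
      rw [h1]
      exact (Nat.pow_le_pow_left (by omega) _).trans (Nat.pow_le_pow_right (by omega) (by omega))
    exact_mod_cast h2
  calc μ N = μ (N ∩ μ.support) := (measure_inter_conull Measure.measure_compl_support).symm
    _ ≤ ∑ κ ∈ J, μ {y | y ∈ N ∩ μ.support ∧ φ y = κ} :=
      (measure_mono hcover).trans (measure_biUnion_finset_le _ _)
    _ ≤ ∑ κ ∈ J, ENNReal.ofReal (C * (3 * d * ρ) ^ d) := Finset.sum_le_sum hcell
    _ = ENNReal.ofReal (J.card * (C * (3 * d * ρ) ^ d)) := by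
      rw [Finset.sum_const, nsmul_eq_mul, ENNReal.ofReal_mul (p := (J.card : ℝ)) (Nat.cast_nonneg _),
        ENNReal.ofReal_natCast]
    _ ≤ _ := by
      refine ENNReal.ofReal_le_ofReal ?_
      have hC0 : 0 ≤ C := zero_le_one.trans hC
      obtain ⟨e, rfl⟩ : ∃ e, d = e + 1 := ⟨d - 1, by omega⟩
      calc _ ≤ (3 * m) ^ e * (C * (3 * (e + 1 : ℕ) * ρ) ^ (e + 1)) :=
            mul_le_mul_of_nonneg_right hcard (by positivity)
        _ = (3 : ℝ) ^ e * (C * (3 * (e + 1 : ℕ)) ^ (e + 1)) / m * t ^ (e + 1) := by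
          rw [htρ]; field_simp; simp only [mul_pow]; ring
        _ ≤ 3 ^ (e + 1) * (C * (3 * (e + 1 : ℕ)) ^ (e + 1)) / m * t ^ (e + 1) := by
          gcongr <;> norm_num
        _ = _ := by
          rw [show (9 : ℝ) * (e + 1 : ℕ) = 3 * (3 * (e + 1 : ℕ)) by ring, mul_pow 3 (3 * _)]
          ring

/-- By comparison of masses, the neighbourhoods of the planes spanned by at most `d` of the points
`p 0, …, p (n - 1)` cannot cover the support inside `B(x, t / 2)`. -/
lemma IsRegularWith.exists_far_from_planes (hd : 1 ≤ d) (hμ : IsRegularWith d C μ) {m : ℕ}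
    (hm : 3 * d ≤ m) (hmC : 2 ^ (d + 1) * (C * (9 * d) ^ d) * (C * 2 ^ d) < m) {x : H}
    (hx : x ∈ μ.support) {t : ℝ} (ht : 0 < t) (htd : ENNReal.ofReal t ≤ Metric.ediam μ.support)
    (p : ℕ → H) {n : ℕ} (hn : n ≤ d + 1) :
    ∃ q ∈ μ.support, q ∈ Metric.closedBall x (t / 2) ∧ ∀ S ⊆ Finset.range n, S.Nonempty →
      S.card ≤ d → t / m ≤ Metric.infDist q (affineSpan ℝ (p '' S) : Set H) := by
  by_contra! hcon
  have hC : 1 ≤ C := hμ.1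
  have hC0 : 0 < C := zero_lt_one.trans_le hC
  have hm0 : (0 : ℝ) < m := by
    have : 1 ≤ m := by omega
    exact_mod_cast this
  set T := (Finset.range n).powerset.filter fun S => S.Nonempty ∧ S.card ≤ d with hT
  have hcover : Metric.closedBall x (t / 2) ∩ μ.support ⊆ ⋃ S ∈ T,
      Metric.closedBall x t ∩
        {y | Metric.infDist y (affineSpan ℝ (p '' S) : Set H) < t / m} := by
    rintro q ⟨hq, hqs⟩
    obtain ⟨S, hS, hS1, hS2, hS3⟩ := hcon q hqs hq
    simp only [Set.mem_iUnion]
    refine ⟨S, ?_, Metric.closedBall_subset_closedBall (by linarith) hq, hS3⟩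
    rw [hT, Finset.mem_filter, Finset.mem_powerset]
    exact ⟨hS, hS1, hS2⟩
  have hpiece : ∀ S ∈ T, μ (Metric.closedBall x t ∩
      {y | Metric.infDist y (affineSpan ℝ (p '' S) : Set H) < t / m}) ≤
      ENNReal.ofReal (C * (9 * d) ^ d / m * t ^ d) := by
    intro S hS
    rw [hT, Finset.mem_filter, Finset.mem_powerset] at hS
    obtain ⟨-, ⟨j, hj⟩, hcard⟩ := hS
    have hfin : (p '' (S : Set ℕ)).Finite := S.finite_toSet.image p
    have hfd : FiniteDimensional ℝ (affineSpan ℝ (p '' (S : Set ℕ))).direction := by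
      rw [direction_affineSpan]; exact finiteDimensional_vectorSpan_of_finite ℝ hfin
    refine hμ.measure_inter_nhd_plane_le x ht htd ?_ ?_ hm
    · exact ⟨p j, subset_affineSpan ℝ _ ⟨j, hj, rfl⟩⟩
    · have h1 : 0 < S.card := Finset.card_pos.2 ⟨j, hj⟩
      classical
      have h2 := finrank_vectorSpan_image_finset_le ℝ p S (n := S.card - 1) (by omega)
      rw [Finset.coe_image] at h2
      rw [direction_affineSpan]
      omega
  have hTcard : (T.card : ℝ) ≤ 2 ^ (d + 1) := by
    have h1 : T.card ≤ 2 ^ n := by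
      refine (Finset.card_filter_le _ _).trans ?_
      rw [Finset.card_powerset, Finset.card_range]
    have h2 : T.card ≤ 2 ^ (d + 1) := h1.trans (Nat.pow_le_pow_right (by norm_num) hn)
    exact_mod_cast h2
  have hlow := (hμ.2.2 x hx (t / 2) (by positivity)
    ((ENNReal.ofReal_le_ofReal (by linarith)).trans htd)).1
  have hup : μ (Metric.closedBall x (t / 2)) ≤
      ENNReal.ofReal (2 ^ (d + 1) * (C * (9 * d) ^ d / m * t ^ d)) := by
    calc _ = μ (Metric.closedBall x (t / 2) ∩ μ.support) :=
          (measure_inter_conull Measure.measure_compl_support).symm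
      _ ≤ _ := (measure_mono hcover).trans (measure_biUnion_finset_le _ _)
      _ ≤ ∑ S ∈ T, ENNReal.ofReal (C * (9 * d) ^ d / m * t ^ d) := Finset.sum_le_sum hpiece
      _ = ENNReal.ofReal (T.card * (C * (9 * d) ^ d / m * t ^ d)) := by
        rw [Finset.sum_const, nsmul_eq_mul, ENNReal.ofReal_mul (p := (T.card : ℝ)) (Nat.cast_nonneg _),
          ENNReal.ofReal_natCast]
      _ ≤ _ := ENNReal.ofReal_le_ofReal (mul_le_mul_of_nonneg_right hTcard (by positivity))
  have h3 := (ENNReal.ofReal_le_ofReal_iff (by positivity)).1 (hlow.trans hup)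
  have h4 : 2 ^ (d + 1) * (C * (9 * d) ^ d / m * t ^ d) < C⁻¹ * (t / 2) ^ d := by
    calc _ = 2 ^ (d + 1) * (C * (9 * d) ^ d) * (C * 2 ^ d) * (t ^ d / (m * C * 2 ^ d)) := by
          field_simp
      _ < m * (t ^ d / (m * C * 2 ^ d)) := mul_lt_mul_of_pos_right hmC (by positivity)
      _ = _ := by rw [div_pow]; field_simp
  exact absurd h3 (not_le.2 h4)

/-- The support of a `d`-regular measure contains, in every ball centred on it, `d + 2` points each
of which is far from all the planes through at most `d` of the preceding ones. -/
lemma IsRegularWith.exists_separated_points (hd : 1 ≤ d) (hμ : IsRegularWith d C μ) {m : ℕ}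
    (hm : 3 * d ≤ m) (hmC : 2 ^ (d + 1) * (C * (9 * d) ^ d) * (C * 2 ^ d) < m) {x : H}
    (hx : x ∈ μ.support) {t : ℝ} (ht : 0 < t) (htd : ENNReal.ofReal t ≤ Metric.ediam μ.support) :
    ∃ p : ℕ → H, ∀ k < d + 2, p k ∈ μ.support ∧ p k ∈ Metric.closedBall x (t / 2) ∧
      ∀ S ⊆ Finset.range k, S.Nonempty → S.card ≤ d →
        t / m ≤ Metric.infDist (p k) (affineSpan ℝ (p '' S) : Set H) := by
  suffices h : ∀ n ≤ d + 2, ∃ p : ℕ → H, ∀ k < n, p k ∈ μ.support ∧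
      p k ∈ Metric.closedBall x (t / 2) ∧ ∀ S ⊆ Finset.range k, S.Nonempty → S.card ≤ d →
        t / m ≤ Metric.infDist (p k) (affineSpan ℝ (p '' S) : Set H) from h _ le_rfl
  intro n
  induction n with
  | zero => exact fun _ => ⟨fun _ => 0, fun k hk => absurd hk (by omega)⟩
  | succ n ih =>
    intro hn
    obtain ⟨p, hp⟩ := ih (by omega)
    obtain ⟨q, hqs, hqx, hq⟩ := hμ.exists_far_from_planes hd hm hmC hx ht htd p (n := n) (by omega)
    refine ⟨Function.update p n q, fun k hk => ?_⟩
    have himage : ∀ S ⊆ Finset.range k, Function.update p n q '' (S : Set ℕ) = p '' S := by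
      intro S hS
      refine Set.image_congr fun j hj => Function.update_of_ne ?_ _ _
      have := Finset.mem_range.1 (hS hj)
      omega
    rcases Nat.lt_succ_iff_lt_or_eq.1 hk with hk' | rfl
    · rw [Function.update_of_ne hk'.ne]
      refine ⟨(hp k hk').1, (hp k hk').2.1, fun S hS h1 h2 => ?_⟩
      rw [himage S hS]
      exact (hp k hk').2.2 S hS h1 h2
    · rw [Function.update_self]
      refine ⟨hqs, hqx, fun S hS h1 h2 => ?_⟩
      rw [himage S hS]
      exact hq S hS h1 h2

end Separation

section Configuration

/-- Around every ball centred on the support of a `d`-regular measure there are `d + 2` smaller balls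
of comparable radius, centred on the support, such that points chosen one in each are mutually far
apart and any `d + 1` of them span a large `d`-volume. All constants depend only on `d` and `C`. -/
lemma exists_separated_balls.{u} {d : ℕ} (hd : 1 ≤ d) (C : ℝ) :
    ∃ c δ lam : ℝ, 0 < c ∧ 0 < δ ∧ δ ≤ 1 / 2 ∧ 0 < lam ∧ lam < 2 ∧
      ∀ (H : Type u) [NormedAddCommGroup H] [InnerProductSpace ℝ H] [MeasurableSpace H]
        [SecondCountableTopology H] (μ : Measure H), IsRegularWith d C μ →
        ∀ x ∈ μ.support, ∀ t : ℝ, 0 < t → ENNReal.ofReal t ≤ Metric.ediam μ.support →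
        ∃ p : Fin (d + 2) → H, (∀ i, p i ∈ μ.support ∧ p i ∈ Metric.closedBall x (t / 2)) ∧
          ∀ z : Fin (d + 2) → H, (∀ i, z i ∈ Metric.closedBall (p i) (δ * t)) →
            (∀ i j, i ≠ j → 2 * lam * t ≤ dist (z i) (z j)) ∧
            ∀ i : Fin (d + 2), c * t ^ d ≤ gramVolume (i.removeNth z) := by
  obtain ⟨m, hm⟩ := exists_nat_gt (max (3 * d : ℝ) (2 ^ (d + 1) * (C * (9 * d) ^ d) * (C * 2 ^ d)))
  have hm3 : 3 * d ≤ m := by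
    have := (le_max_left _ _).trans_lt hm
    exact_mod_cast this.le
  have hmC := (le_max_right _ _).trans_lt hm
  have hm1 : 1 ≤ m := by omega
  have hm1' : (1 : ℝ) ≤ m := by exact_mod_cast hm1
  have hm0 : (0 : ℝ) < m := by exact_mod_cast hm1
  obtain ⟨δ₀, hδ₀, hpert⟩ := exists_gramVolume_perturb.{u} d
    (c := (1 / m) ^ d) (by positivity)
  have hm4 : 1 / (4 * m : ℝ) ≤ 1 / 4 := one_div_le_one_div_of_le (by norm_num) (by linarith)
  -- the centres are `t / m`-separated, so a radius of `t / (4 m)` leaves gaps of `t / (2 m)`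
  refine ⟨(1 / m) ^ d / 2, min δ₀ (1 / (4 * m)), 1 / (4 * m), by positivity, by positivity,
    (min_le_right _ _).trans (by linarith), by positivity, by linarith, ?_⟩
  intro H _ _ _ _ μ hμ x hx t ht htd
  set δ := min δ₀ (1 / (4 * m)) with hδ
  have hδ1 : δ ≤ δ₀ := min_le_left _ _
  have hδ2 : δ ≤ 1 / (4 * m) := min_le_right _ _
  obtain ⟨p, hp⟩ := hμ.exists_separated_points hd hm3 hmC hx ht htd
  have hpdist : ∀ i j : Fin (d + 2), j < i → t / m ≤ dist (p i) (p j) := by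
    intro i j hji
    have h := (hp i i.isLt).2.2 {(j : ℕ)} (by simpa using hji) (Finset.singleton_nonempty _)
      (by simpa using hd)
    refine h.trans (Metric.infDist_le_dist_of_mem (subset_affineSpan ℝ _ ?_))
    simp
  refine ⟨fun i => p i, fun i => ⟨(hp i i.isLt).1, (hp i i.isLt).2.1⟩, fun z hz => ⟨?_, ?_⟩⟩
  · have key : ∀ i j : Fin (d + 2), j < i → 2 * (1 / (4 * m)) * t ≤ dist (z i) (z j) := by
      intro i j hji
      have h1 := hpdist i j hji
      have h2 := hz i
      have h3 := hz j
      rw [Metric.mem_closedBall] at h2 h3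
      have h4 : dist (p i) (p j) ≤ dist (z i) (p i) + dist (z i) (z j) + dist (z j) (p j) := by
        rw [dist_comm (z i) (p i)]
        exact dist_triangle4 _ _ _ _
      have h5 : δ * t ≤ 1 / (4 * m) * t := mul_le_mul_of_nonneg_right hδ2 ht.le
      have h6 : t / m = 4 * (1 / (4 * m) * t) := by field_simp
      linarith
    intro i j hij
    rcases lt_or_gt_of_ne hij with h | h
    · rw [dist_comm]; exact key j i h
    · exact key i j h
  · intro (i : Fin (d + 2))
    have hzx : ∀ k, dist (z k) x ≤ t := by
      intro k
      have h2 := hz k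
      have h3 := (hp k k.isLt).2.1
      rw [Metric.mem_closedBall] at h2 h3
      have h5 : δ * t ≤ 1 / 4 * t := mul_le_mul_of_nonneg_right (hδ2.trans hm4) ht.le
      linarith [dist_triangle (z k) (p k) x]
    have hpx : ∀ k : Fin (d + 2), dist (p k) x ≤ t := fun k => by
      have h3 := (hp k k.isLt).2.1
      rw [Metric.mem_closedBall] at h3
      linarith
    refine hpert H t (i.removeNth fun k : Fin (d + 2) => p k) _ ht ?_ ?_ ?_ ?_
    · intro j k
      have := dist_triangle_right (p (i.succAbove j)) (p (i.succAbove k)) x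
      simp only [Fin.removeNth_apply]
      linarith [hpx (i.succAbove j), hpx (i.succAbove k)]
    · intro j k
      have := dist_triangle_right (z (i.succAbove j)) (z (i.succAbove k)) x
      simp only [Fin.removeNth_apply]
      linarith [hzx (i.succAbove j), hzx (i.succAbove k)]
    · intro j
      simp only [Fin.removeNth_apply]
      rw [dist_comm]
      exact (Metric.mem_closedBall.1 (hz _)).trans (mul_le_mul_of_nonneg_right hδ1 ht.le)
    · rw [← mul_pow, one_div_mul_eq_div]
      refine pow_le_gramVolume (by positivity) _ fun k hk => ?_
      let S : Finset ℕ := (Finset.Iio k).image fun j => (i.succAbove j : ℕ)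
      have hSimage : (i.removeNth fun k : Fin (d + 2) => p k) '' {j | j < k} = p '' S := by
        ext q
        simp [S, Fin.removeNth_apply]
      rw [hSimage, Fin.removeNth_apply]
      refine (hp _ (i.succAbove k).isLt).2.2 S ?_ ?_ ?_
      · intro j hj
        obtain ⟨j', hj', rfl⟩ := Finset.mem_image.1 hj
        exact Finset.mem_range.2 (Fin.strictMono_succAbove i (Finset.mem_Iio.1 hj'))
      · exact ⟨_, Finset.mem_image_of_mem _ (Finset.mem_Iio.2 (Fin.pos_iff_ne_zero.2 hk))⟩
      · refine Finset.card_image_le.trans ?_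
        rw [Fin.card_Iio]
        omega

end Configuration

/-! ### Edge lengths, content and curvature of simplices -/

section Curvature

variable {H : Type*} [NormedAddCommGroup H]

lemma le_minEdge_iff {d : ℕ} {X : Fin (d + 2) → H} {s : ℝ} :
    s ≤ minEdge X ↔ ∀ i j, i ≠ j → s ≤ dist (X i) (X j) := by
  have : Nonempty {p : Fin (d + 2) × Fin (d + 2) // p.1 ≠ p.2} := ⟨⟨(0, 1), by simp⟩⟩
  rw [minEdge, le_ciInf_iff (Set.finite_range _).bddBelow]
  exact ⟨fun h i j hij => h ⟨(i, j), hij⟩, fun h q => h _ _ q.2⟩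

lemma dist_le_simplexDiam {d : ℕ} (X : Fin (d + 2) → H) (i j : Fin (d + 2)) :
    dist (X i) (X j) ≤ simplexDiam X :=
  Metric.dist_le_diam_of_mem (Set.finite_range X).isBounded ⟨i, rfl⟩ ⟨j, rfl⟩

lemma simplexDiam_le_iff {d : ℕ} {X : Fin (d + 2) → H} {s : ℝ} (hs : 0 ≤ s) :
    simplexDiam X ≤ s ↔ ∀ i j, dist (X i) (X j) ≤ s := by
  refine ⟨fun h i j => (dist_le_simplexDiam X i j).trans h, fun h => ?_⟩
  refine Metric.diam_le_of_forall_dist_le hs ?_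
  rintro _ ⟨i, rfl⟩ _ ⟨j, rfl⟩
  exact h i j

lemma minEdge_le_simplexDiam {d : ℕ} (X : Fin (d + 2) → H) : minEdge X ≤ simplexDiam X :=
  (le_minEdge_iff.1 le_rfl 0 1 (by simp)).trans (dist_le_simplexDiam X 0 1)

lemma dist_le_two_mul {ι : Type*} {X : ι → H} {x : H} {t : ℝ}
    (hX : ∀ i, X i ∈ Metric.closedBall x t) (i j : ι) : dist (X i) (X j) ≤ 2 * t := by
  have h1 := Metric.mem_closedBall.1 (hX i)
  have h2 := Metric.mem_closedBall.1 (hX j)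
  linarith [dist_triangle_right (X i) (X j) x]

lemma isClosed_bigSimplices (d : ℕ) (x : H) (t lam : ℝ) : IsClosed (bigSimplices d x t lam) := by
  simp only [bigSimplices, le_minEdge_iff, Metric.mem_closedBall, Set.ofPred_and, Set.ofPred_forall]
  refine (isClosed_iInter fun i => isClosed_le (by fun_prop) (by fun_prop)).inter
    (isClosed_iInter fun i => isClosed_iInter fun j => isClosed_iInter fun _ =>
      isClosed_le (by fun_prop) (by fun_prop))

lemma measurable_simplexDiam [MeasurableSpace H] [BorelSpace H]
    [SecondCountableTopology H] {d : ℕ} : Measurable (simplexDiam : (Fin (d + 2) → H) → ℝ) := by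
  refine measurable_of_Iic fun s => ?_
  rcases lt_or_ge s 0 with hs | hs
  · convert MeasurableSet.empty
    ext X
    simp only [Set.mem_preimage, Set.mem_Iic, Set.mem_empty_iff_false, iff_false, not_le]
    exact hs.trans_le Metric.diam_nonneg
  · have : simplexDiam ⁻¹' Set.Iic s = {X : Fin (d + 2) → H | ∀ i j, dist (X i) (X j) ≤ s} := by
      ext X
      exact simplexDiam_le_iff hs
    rw [this]
    simp only [Set.ofPred_forall]
    exact (isClosed_iInter fun i => isClosed_iInter fun j =>
      isClosed_le (by fun_prop) (by fun_prop)).measurableSet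

variable [InnerProductSpace ℝ H]

/-- On simplices in `B(x,t)` without short edges the curvature controls the content. -/
lemma content_sq_le_mul_cMT_sq {d : ℕ} {X : Fin (d + 2) → H} {x : H} {t lam : ℝ} (ht : 0 < t)
    (hlam : 0 < lam) (hX : X ∈ bigSimplices d x t lam) :
    content X ^ 2 ≤ (2 * t) ^ ((d + 1) * (d + 2)) * cMT X ^ 2 := by
  obtain ⟨hXB, hXmin⟩ := hX
  have hlt : 0 < lam * t := by positivity
  have hpos : ∀ i j, i ≠ j → 0 < ‖X j - X i‖ := by
    intro i j hij
    rw [← dist_eq_norm]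
    exact hlt.trans_le (le_minEdge_iff.1 hXmin j i hij.symm)
  have hle : ∀ i j, ‖X j - X i‖ ≤ 2 * t := fun i j => by
    rw [← dist_eq_norm]; exact dist_le_two_mul hXB j i
  have hD0 : 0 < simplexDiam X := hlt.trans_le (hXmin.trans (minEdge_le_simplexDiam X))
  have hDt : simplexDiam X ≤ 2 * t :=
    (simplexDiam_le_iff (by positivity)).2 (dist_le_two_mul hXB)
  have hps : ∀ i, content X ^ 2 / (2 * t) ^ (2 * (d + 1)) ≤ polarSine X i ^ 2 := by
    intro i
    have hprod0 : 0 < ∏ j ∈ Finset.univ.erase i, ‖X j - X i‖ :=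
      Finset.prod_pos fun j hj => hpos i j (Finset.ne_of_mem_erase hj).symm
    have hprod : ∏ j ∈ Finset.univ.erase i, ‖X j - X i‖ ≤ (2 * t) ^ (d + 1) := by
      refine (Finset.prod_le_prod (fun _ _ => norm_nonneg _) fun j _ => hle i j).trans_eq ?_
      rw [Finset.prod_const, Finset.card_erase_of_mem (Finset.mem_univ _), Finset.card_univ, Fintype.card_fin]
      rfl
    rw [polarSine, div_pow, mul_comm 2 (d + 1), pow_mul]
    gcongr
  have hsum : ((d : ℝ) + 2) * (content X ^ 2 / (2 * t) ^ (2 * (d + 1))) ≤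
      ∑ i, polarSine X i ^ 2 := by
    have := Finset.card_nsmul_le_sum Finset.univ _ _ fun i _ => hps i
    rw [Finset.card_univ, Fintype.card_fin, nsmul_eq_mul] at this
    push_cast at this
    exact this
  have hd2 : (0 : ℝ) < d + 2 := by positivity
  rw [cMT, Real.sq_sqrt (by positivity)]
  calc content X ^ 2 = (2 * t) ^ ((d + 1) * (d + 2)) * (1 / ((d : ℝ) + 2) *
        (1 / (2 * t) ^ (d * (d + 1))) *
        (((d : ℝ) + 2) * (content X ^ 2 / (2 * t) ^ (2 * (d + 1))))) := by
        rw [show (d + 1) * (d + 2) = d * (d + 1) + 2 * (d + 1) by ring, pow_add]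
        field_simp
    _ ≤ _ := by gcongr

/-- A tuple with non-zero Gram volume spans a `d`-plane. -/
lemma isPlane_affineSpan {d : ℕ} {z : Fin (d + 1) → H} (hz : 0 < gramVolume z) :
    IsPlane d (affineSpan ℝ (Set.range z)) := by
  have hdet : (Matrix.gram ℝ fun i : Fin d => z i.succ - z 0).det ≠ 0 := fun h => by
    rw [gramVolume, h, Real.sqrt_zero] at hz
    exact hz.false
  have hli := Matrix.linearIndependent_of_det_gram_ne_zero hdet
  have hspan : vectorSpan ℝ (Set.range z) =
      Submodule.span ℝ (Set.range fun i : Fin d => z i.succ - z 0) := by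
    rw [vectorSpan_range_eq_span_range_vsub_right ℝ z 0]
    refine le_antisymm (Submodule.span_le.2 ?_) (Submodule.span_mono ?_)
    · rintro _ ⟨i, rfl⟩
      refine Fin.cases ?_ (fun i => ?_) i
      · simp
      · exact Submodule.subset_span ⟨i, rfl⟩
    · rintro _ ⟨i, rfl⟩
      exact ⟨i.succ, rfl⟩
  refine ⟨⟨z 0, subset_affineSpan ℝ _ ⟨0, rfl⟩⟩, ?_, ?_⟩
  · rw [direction_affineSpan]; infer_instance
  · rw [direction_affineSpan, hspan, finrank_span_eq_card hli, Fintype.card_fin]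

lemma continuous_gramVolume {n : ℕ} : Continuous (gramVolume : (Fin (n + 1) → H) → ℝ) := by
  refine Real.continuous_sqrt.comp (Continuous.matrix_det ?_)
  refine continuous_matrix fun i j => ?_
  simp only [Matrix.gram_apply]
  fun_prop

variable [MeasurableSpace H] [BorelSpace H] [SecondCountableTopology H]

lemma measurable_cMT {d : ℕ} : Measurable (cMT : (Fin (d + 2) → H) → ℝ) := by
  have h1 : Measurable (content : (Fin (d + 2) → H) → ℝ) := continuous_gramVolume.measurable
  have h2 : ∀ i, Measurable fun X : Fin (d + 2) → H => polarSine X i := fun i => by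
    refine h1.div (Continuous.measurable ?_)
    fun_prop
  have h3 := measurable_simplexDiam (H := H) (d := d)
  unfold cMT
  fun_prop

end Curvature

/-! ### Integration over one vertex -/

section Averaging

variable {α : Type*} [MeasurableSpace α] (μ : Measure α) [SigmaFinite μ]

lemma lintegral_insertNth {n : ℕ} (i : Fin (n + 1)) {f : (Fin (n + 1) → α) → ℝ≥0∞}
    (hf : Measurable f) :
    ∫⁻ z, ∫⁻ y, f (i.insertNth y z) ∂μ ∂(Measure.pi fun _ : Fin n => μ) =
      ∫⁻ X, f X ∂(Measure.pi fun _ : Fin (n + 1) => μ) := by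
  have hmp := (measurePreserving_piFinSuccAbove (fun _ : Fin (n + 1) => μ) i).symm
  rw [← hmp.lintegral_comp hf, lintegral_prod_symm]
  · rfl
  · exact (hf.comp hmp.measurable).aemeasurable

lemma setLIntegral_removeNth {n : ℕ} (i : Fin (n + 1)) {s : Set α} (hs : MeasurableSet s)
    {F : (Fin n → α) → ℝ≥0∞} (hF : Measurable F) :
    ∫⁻ X in {X | X i ∈ s}, F (i.removeNth X) ∂(Measure.pi fun _ : Fin (n + 1) => μ) =
      μ s * ∫⁻ z, F z ∂(Measure.pi fun _ : Fin n => μ) := by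
  have hmp := measurePreserving_piFinSuccAbove (fun _ : Fin (n + 1) => μ) i
  have h := hmp.setLIntegral_comp_preimage (s := s ×ˢ Set.univ) (hs.prod MeasurableSet.univ)
    (f := fun q => F q.2) (hF.comp measurable_snd)
  have hset : (MeasurableEquiv.piFinSuccAbove (fun _ => α) i) ⁻¹' (s ×ˢ Set.univ) =
      {X | X i ∈ s} := by
    ext X
    simp [MeasurableEquiv.piFinSuccAbove, Fin.insertNthEquiv]
  rw [hset] at h
  refine Eq.trans ?_ (h.trans ?_)
  · rfl
  · rw [← Measure.prod_restrict, Measure.restrict_univ, lintegral_prod _ (by fun_prop)]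
    simp [mul_comm]

end Averaging

/-! ### The single-scale estimate -/

section SingleScale

variable {H : Type*} [NormedAddCommGroup H] [InnerProductSpace ℝ H]


/-- The pointwise estimate behind the averaging: for a simplex `X` with large `d`-faces and
separated vertices, the distance from `y` to the plane of the last face is controlled by the content
of `X` and of the simplex obtained by exchanging a suitable vertex for `y`. -/
lemma ofReal_infDist_sq_le {d : ℕ} (hd : 1 ≤ d) {x : H} {t c lam : ℝ} (hc : 0 < c) (ht : 0 < t)
    (X : Fin (d + 2) → H) (hX : ∀ i, X i ∈ Metric.closedBall x t)
    (hsep : ∀ i j, i ≠ j → 2 * lam * t ≤ dist (X i) (X j)) (hlam : 0 < lam)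
    (hvol : ∀ i : Fin (d + 2), c * t ^ d ≤ gramVolume (i.removeNth X))
    {y : H} (hy : y ∈ Metric.closedBall x t) :
    ENNReal.ofReal (Metric.infDist y
      (affineSpan ℝ (Set.range ((Fin.last (d + 1)).removeNth X)) : Set H) ^ 2) ≤
      ENNReal.ofReal (2 * (1 + 2 ^ d / c) ^ 2 / (c * t ^ d) ^ 2) *
      (∑ i : Fin (d + 2), (bigSimplices d x t lam).indicator
          (fun X => ENNReal.ofReal (content X ^ 2))
          ((Fin.last (d + 1)).insertNth y (i.removeNth X)) +
        (bigSimplices d x t lam).indicator (fun X => ENNReal.ofReal (content X ^ 2)) X) := by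
  set g : (Fin (d + 2) → H) → ℝ≥0∞ :=
    (bigSimplices d x t lam).indicator (fun X => ENNReal.ofReal (content X ^ 2)) with hg
  set L := affineSpan ℝ (Set.range ((Fin.last (d + 1)).removeNth X)) with hL
  have hct : 0 < c * t ^ d := by positivity
  have hlt : 0 < lam * t := by positivity
  -- at most one vertex of `X` is too close to `y`
  obtain ⟨i, hi⟩ : ∃ i : Fin (d + 2), ∀ j, j ≠ i → lam * t ≤ dist y (X j) := by
    by_cases h : ∀ j, lam * t ≤ dist y (X j)
    · exact ⟨0, fun j _ => h j⟩
    · push Not at h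
      obtain ⟨i, hi⟩ := h
      refine ⟨i, fun j hj => ?_⟩
      have h1 := hsep j i hj
      have h2 := dist_triangle_left (X j) (X i) y
      linarith
  set Y : Fin (d + 2) → H := (Fin.last (d + 1)).insertNth y (i.removeNth X) with hY
  have hYlast : Y (Fin.last (d + 1)) = y := by rw [hY, Fin.insertNth_apply_same]
  have hYface : (Fin.last (d + 1)).removeNth Y = i.removeNth X := by
    rw [hY, Fin.removeNth_insertNth]
  have hYcast : ∀ j : Fin (d + 1), Y j.castSucc = X (i.succAbove j) := fun j => by
    rw [← removeNth_last_apply Y j, hYface, Fin.removeNth_apply]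
  have hYU : Y ∈ bigSimplices d x t lam := by
    refine ⟨fun j => ?_, le_minEdge_iff.2 fun j k => ?_⟩
    · refine Fin.lastCases ?_ (fun j => ?_) j
      · rw [hYlast]; exact hy
      · rw [hYcast]; exact hX _
    · refine Fin.lastCases ?_ (fun j => ?_) j <;> refine Fin.lastCases ?_ (fun k => ?_) k <;>
        intro hjk
      · exact absurd rfl hjk
      · rw [hYlast, hYcast]; exact hi _ (Fin.succAbove_ne i k)
      · rw [hYlast, hYcast, dist_comm]; exact hi _ (Fin.succAbove_ne i j)
      · rw [hYcast, hYcast]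
        have hne : i.succAbove j ≠ i.succAbove k := fun h =>
          hjk (congrArg _ (Fin.succAbove_right_injective h))
        linarith [hsep _ _ hne]
  have hXU : X ∈ bigSimplices d x t lam :=
    ⟨hX, le_minEdge_iff.2 fun j k hjk => by linarith [hsep j k hjk]⟩
  set a := Metric.infDist y (affineSpan ℝ (Set.range (i.removeNth X)) : Set H) with ha
  set b := Metric.infDist (X (Fin.last (d + 1))) (L : Set H) with hb
  have ha0 : 0 ≤ a := Metric.infDist_nonneg
  have hb0 : 0 ≤ b := Metric.infDist_nonneg
  have hya : c * t ^ d * a ≤ content Y := by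
    rw [content_eq_gramVolume, gramVolume_eq_mul_infDist, hYlast, hYface]
    exact mul_le_mul_of_nonneg_right (hvol i) ha0
  have hxb : c * t ^ d * b ≤ content X := by
    rw [content_eq_gramVolume, gramVolume_eq_mul_infDist]
    exact mul_le_mul_of_nonneg_right (hvol _) hb0
  have hmain : Metric.infDist y (L : Set H) ≤ (1 + 2 ^ d / c) * (a + b) :=
    infDist_le_of_face hd X i y hc ht (dist_le_two_mul hX)
      (fun j => by
        have h1 := Metric.mem_closedBall.1 hy
        have h2 := Metric.mem_closedBall.1 (hX j)
        linarith [dist_triangle_right y (X j) x]) (hvol i)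
  have hreal : Metric.infDist y (L : Set H) ^ 2 ≤
      2 * (1 + 2 ^ d / c) ^ 2 / (c * t ^ d) ^ 2 * (content Y ^ 2 + content X ^ 2) := by
    have h0 : 0 ≤ Metric.infDist y (L : Set H) := Metric.infDist_nonneg
    have h1 : (c * t ^ d * a) ^ 2 ≤ content Y ^ 2 := pow_le_pow_left₀ (by positivity) hya 2
    have h2 : (c * t ^ d * b) ^ 2 ≤ content X ^ 2 := pow_le_pow_left₀ (by positivity) hxb 2
    calc _ ≤ ((1 + 2 ^ d / c) * (a + b)) ^ 2 := pow_le_pow_left₀ h0 hmain 2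
      _ ≤ 2 * (1 + 2 ^ d / c) ^ 2 * (a ^ 2 + b ^ 2) := by
        rw [mul_pow]
        nlinarith [sq_nonneg (a - b), mul_nonneg (sq_nonneg (1 + 2 ^ d / c)) (sq_nonneg (a - b))]
      _ = 2 * (1 + 2 ^ d / c) ^ 2 / (c * t ^ d) ^ 2 *
          ((c * t ^ d * a) ^ 2 + (c * t ^ d * b) ^ 2) := by
        field_simp
      _ ≤ _ := by gcongr
  refine (ENNReal.ofReal_le_ofReal hreal).trans ?_
  rw [ENNReal.ofReal_mul (by positivity), ENNReal.ofReal_add (by positivity) (by positivity)]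
  refine mul_le_mul_right (add_le_add ?_ ?_) _
  · refine le_trans (le_of_eq ?_) (Finset.single_le_sum (f := fun i : Fin (d + 2) =>
      g ((Fin.last (d + 1)).insertNth y (i.removeNth X))) (fun _ _ => zero_le) (Finset.mem_univ i))
    change _ = g Y
    rw [hg, Set.indicator_of_mem hYU]
  · rw [hg, Set.indicator_of_mem hXU]

variable [MeasurableSpace H]

/-- Every `d`-plane bounds `β₂`. If the ball has measure zero, both `β₂` and the left-hand side
vanish. -/
lemma beta2_sq_mul_measure_le {d : ℕ} {μ : Measure H} {x : H} {t : ℝ} (ht : 0 < t)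
    (hfin : μ (Metric.closedBall x t) ≠ ∞) {L : AffineSubspace ℝ H} (hL : IsPlane d L) :
    beta2 d μ x t ^ 2 * μ (Metric.closedBall x t) ≤
      ENNReal.ofReal (1 / (2 * t) ^ 2) *
        ∫⁻ y in Metric.closedBall x t, ENNReal.ofReal (Metric.infDist y (L : Set H) ^ 2) ∂μ := by
  rw [beta2]
  split_ifs with h0
  · simp
  · rw [← ENNReal.rpow_natCast, ← ENNReal.rpow_mul]
    norm_num only
    rw [ENNReal.rpow_one, ← lintegral_const_mul' _ _ ENNReal.ofReal_ne_top]
    calc _ ≤ (∫⁻ y in Metric.closedBall x t,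
          ENNReal.ofReal ((Metric.infDist y (L : Set H) / (2 * t)) ^ 2) ∂μ) /
          μ (Metric.closedBall x t) * μ (Metric.closedBall x t) :=
          mul_le_mul_left (iInf₂_le L hL) _
      _ = ∫⁻ y in Metric.closedBall x t,
          ENNReal.ofReal ((Metric.infDist y (L : Set H) / (2 * t)) ^ 2) ∂μ :=
          ENNReal.div_mul_cancel h0 hfin
      _ = _ := by
        refine lintegral_congr fun y => ?_
        rw [← ENNReal.ofReal_mul (by positivity)]
        congr 1
        rw [div_pow]; ring

variable [BorelSpace H] [SecondCountableTopology H]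

/-- Averaging the pointwise estimate over the simplices with one vertex in each `B i` yields one plane
that approximates `μ` well in mean square. -/
lemma exists_plane_of_separated {d : ℕ} (hd : 1 ≤ d) {μ : Measure H} [SigmaFinite μ] {x : H}
    {t c lam : ℝ} (hc : 0 < c) (ht : 0 < t) (hlam : 0 < lam)
    (hfin : μ (Metric.closedBall x t) ≠ ∞) {B : Fin (d + 2) → Set H}
    (hBx : ∀ i, B i ⊆ Metric.closedBall x t)
    (hB0 : ∀ i, μ (B i) ≠ 0)
    (hsep : ∀ z : Fin (d + 2) → H, (∀ i, z i ∈ B i) →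
      (∀ i j, i ≠ j → 2 * lam * t ≤ dist (z i) (z j)) ∧
        ∀ i : Fin (d + 2), c * t ^ d ≤ gramVolume (i.removeNth z)) :
    ∃ L : AffineSubspace ℝ H, IsPlane d L ∧
      ∫⁻ y in Metric.closedBall x t, ENNReal.ofReal (Metric.infDist y (L : Set H) ^ 2) ∂μ ≤
      ENNReal.ofReal (2 * (1 + 2 ^ d / c) ^ 2 / (c * t ^ d) ^ 2) *
        ((d + 3) * μ (Metric.closedBall x t) *
          (∫⁻ X in bigSimplices d x t lam, ENNReal.ofReal (content X ^ 2)
            ∂(Measure.pi fun _ : Fin (d + 2) => μ)) / ∏ i, μ (B i)) := by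
  set ν := Measure.pi fun _ : Fin (d + 2) => μ with hν
  set A := Metric.closedBall x t with hA
  have hAm : MeasurableSet A := measurableSet_closedBall
  set U := bigSimplices d x t lam with hU
  have hUm : MeasurableSet U := (isClosed_bigSimplices d x t lam).measurableSet
  set g : (Fin (d + 2) → H) → ℝ≥0∞ :=
    U.indicator (fun X => ENNReal.ofReal (content X ^ 2)) with hg
  have hgm : Measurable g := by
    refine Measurable.indicator ?_ hUm
    have : Measurable (content : (Fin (d + 2) → H) → ℝ) := continuous_gramVolume.measurable
    fun_prop
  have hins : Measurable fun q : (Fin (d + 1) → H) × H =>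
      (Fin.last (d + 1)).insertNth (α := fun _ => H) q.2 q.1 :=
    (MeasurableEquiv.piFinSuccAbove (fun _ => H) (Fin.last (d + 1))).symm.measurable.comp
      measurable_swap
  have hgi : Measurable fun q : (Fin (d + 1) → H) × H =>
      g ((Fin.last (d + 1)).insertNth (α := fun _ => H) q.2 q.1) := hgm.comp hins
  let F : (Fin (d + 1) → H) → ℝ≥0∞ := fun z =>
    ∫⁻ y, g ((Fin.last (d + 1)).insertNth (α := fun _ => H) y z) ∂μ
  have hFm : Measurable F := hgi.lintegral_prod_right'
  set I := ∫⁻ X in U, ENNReal.ofReal (content X ^ 2) ∂ν with hI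
  have hgI : ∫⁻ X, g X ∂ν = I := lintegral_indicator hUm _
  have hFI : ∫⁻ z, F z ∂(Measure.pi fun _ : Fin (d + 1) => μ) = I :=
    (lintegral_insertNth μ (Fin.last (d + 1)) hgm).trans hgI
  have hFr : ∀ i : Fin (d + 2), Measurable fun X : Fin (d + 2) → H => F (i.removeNth X) := fun i =>
    hFm.comp (measurable_pi_iff.2 fun j => measurable_pi_apply _)
  -- the bound obtained from the face plane of `X` by integrating the pointwise estimate in `y`
  let Φ : (Fin (d + 2) → H) → ℝ≥0∞ := fun X =>
    ∑ i : Fin (d + 2), F (i.removeNth X) + g X * μ A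
  have hsumm : Measurable fun X : Fin (d + 2) → H => ∑ i : Fin (d + 2), F (i.removeNth X) :=
    Finset.measurable_fun_sum _ fun i _ => hFr i
  have hΦm : Measurable Φ := hsumm.add (hgm.mul_const _)
  set G : Set (Fin (d + 2) → H) := Set.univ.pi B with hG
  have hνG : ν G = ∏ i, μ (B i) := Measure.pi_pi _ _
  have hΦG : ∫⁻ X in G, Φ X ∂ν ≤ (d + 3) * μ A * I := by
    calc ∫⁻ X in G, Φ X ∂ν
        = ∑ i : Fin (d + 2), ∫⁻ X in G, F (i.removeNth X) ∂ν + ∫⁻ X in G, g X * μ A ∂ν := by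
          rw [lintegral_add_left hsumm, lintegral_finsetSum _ fun i _ => hFr i]
      _ ≤ ∑ i : Fin (d + 2), μ A * I + I * μ A := by
          refine add_le_add (Finset.sum_le_sum fun i _ => ?_) ?_
          · rw [← hFI, ← setLIntegral_removeNth μ i hAm hFm]
            exact lintegral_mono_set fun X hX => hBx i (hX i trivial)
          · rw [lintegral_mul_const _ hgm, ← hgI]
            exact mul_le_mul_left (setLIntegral_le_lintegral _ _) _
      _ = _ := by
          rw [Finset.sum_const, Finset.card_univ, Fintype.card_fin, nsmul_eq_mul]
          push_cast
          ring
  obtain ⟨X, hXG, hX⟩ := exists_le_setLAverage (s := G) (μ := ν)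
    (by rw [hνG]; exact Finset.prod_ne_zero_iff.2 fun i _ => hB0 i)
    (by
      rw [hνG]
      exact ENNReal.prod_ne_top fun i _ => ((measure_mono (hBx i)).trans_lt hfin.lt_top).ne)
    hΦm.aemeasurable
  have hXB : ∀ i, X i ∈ B i := fun i => hXG i trivial
  obtain ⟨hXsep, hXvol⟩ := hsep X hXB
  refine ⟨affineSpan ℝ (Set.range ((Fin.last (d + 1)).removeNth X)),
    isPlane_affineSpan ((by positivity : 0 < c * t ^ d).trans_le (hXvol _)), ?_⟩
  calc _ ≤ ∫⁻ y in A, ENNReal.ofReal (2 * (1 + 2 ^ d / c) ^ 2 / (c * t ^ d) ^ 2) *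
        (∑ i : Fin (d + 2), g ((Fin.last (d + 1)).insertNth y (i.removeNth X)) + g X) ∂μ :=
        setLIntegral_mono' hAm fun y hy => ofReal_infDist_sq_le hd hc ht X
          (fun i => hBx i (hXB i)) hXsep hlam hXvol hy
    _ = ENNReal.ofReal (2 * (1 + 2 ^ d / c) ^ 2 / (c * t ^ d) ^ 2) *
        (∑ i : Fin (d + 2), ∫⁻ y in A, g ((Fin.last (d + 1)).insertNth y (i.removeNth X)) ∂μ +
          g X * μ A) := by
        rw [lintegral_const_mul' _ _ ENNReal.ofReal_ne_top, lintegral_add_right _ measurable_const,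
          setLIntegral_const, lintegral_finsetSum]
        exact fun i _ => hgi.comp measurable_prodMk_left
    _ ≤ ENNReal.ofReal (2 * (1 + 2 ^ d / c) ^ 2 / (c * t ^ d) ^ 2) * Φ X :=
        mul_le_mul_right (add_le_add_left
          (Finset.sum_le_sum fun i _ => setLIntegral_le_lintegral _ _) _) _
    _ ≤ _ := by
        refine mul_le_mul_right (hX.trans ?_) _
        rw [setLAverage_eq, hνG]
        exact ENNReal.div_le_div_right hΦG _

end SingleScale

section SingleScaleEstimate

/-- The single-scale estimate `β₂² μ(B) ≤ C₁ c_MT²`, with constants that depend only on `d` and `C`. -/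
theorem exists_beta2_sq_mul_le.{u} {d : ℕ} (hd : 1 ≤ d) {C : ℝ} (hC : 1 ≤ C) :
    ∃ lam C₁ : ℝ, 0 < lam ∧ lam < 2 ∧ 1 ≤ C₁ ∧
      ∀ (H : Type u) [NormedAddCommGroup H] [InnerProductSpace ℝ H] [MeasurableSpace H]
        [BorelSpace H] [SecondCountableTopology H] (μ : Measure H), IsRegularWith d C μ →
        ∀ x ∈ μ.support, ∀ t : ℝ, 0 < t → ENNReal.ofReal t ≤ Metric.ediam μ.support →
          beta2 d μ x t ^ 2 * μ (Metric.closedBall x t) ≤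
            ENNReal.ofReal C₁ * localCurvature d μ x t lam := by
  obtain ⟨c, δ, lam, hc, hδ, hδ2, hlam, hlam2, hconf⟩ := exists_separated_balls.{u} hd C
  have hC0 : 0 < C := zero_lt_one.trans_le hC
  set K : ℝ := 1 / 4 * (2 * (1 + 2 ^ d / c) ^ 2 / c ^ 2) * (d + 3) * C *
    ((C⁻¹ * δ ^ d) ^ (d + 2))⁻¹ * 2 ^ ((d + 1) * (d + 2)) with hK
  refine ⟨lam, max 1 K, hlam, hlam2, le_max_left _ _, ?_⟩
  intro H _ _ _ _ _ μ hμ x hx t ht htd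
  obtain ⟨p, hp, hpz⟩ := hconf H μ hμ x hx t ht htd
  have hlf : IsLocallyFiniteMeasure μ := hμ.2.1
  have hup := (hμ.2.2 x hx t ht htd).2
  have hfin : μ (Metric.closedBall x t) ≠ ∞ := (hup.trans_lt ENNReal.ofReal_lt_top).ne
  have hδt : δ * t ≤ 1 / 2 * t := mul_le_mul_of_nonneg_right hδ2 ht.le
  have hlow : ∀ i, ENNReal.ofReal (C⁻¹ * (δ * t) ^ d) ≤ μ (Metric.closedBall (p i) (δ * t)) :=
    fun i => (hμ.2.2 (p i) (hp i).1 (δ * t) (by positivity)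
      ((ENNReal.ofReal_le_ofReal (by linarith)).trans htd)).1
  have hlow0 : 0 < C⁻¹ * (δ * t) ^ d := by positivity
  obtain ⟨L, hL, hLint⟩ := exists_plane_of_separated hd hc ht hlam hfin
    (B := fun i => Metric.closedBall (p i) (δ * t))
    (fun i => Metric.closedBall_subset_closedBall' (by
      have := Metric.mem_closedBall.1 (hp i).2
      linarith))
    (fun i => ((ENNReal.ofReal_pos.2 hlow0).trans_le (hlow i)).ne') hpz
  have hprod : ENNReal.ofReal ((C⁻¹ * (δ * t) ^ d) ^ (d + 2)) ≤
      ∏ i, μ (Metric.closedBall (p i) (δ * t)) := by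
    have := Finset.prod_le_prod' (s := Finset.univ) fun i _ => hlow i
    rwa [Finset.prod_const, Finset.card_univ, Fintype.card_fin,
      ← ENNReal.ofReal_pow hlow0.le] at this
  have hI : ∫⁻ X in bigSimplices d x t lam, ENNReal.ofReal (content X ^ 2)
      ∂(Measure.pi fun _ : Fin (d + 2) => μ) ≤
      ENNReal.ofReal ((2 * t) ^ ((d + 1) * (d + 2))) * localCurvature d μ x t lam := by
    rw [localCurvature, ← lintegral_const_mul' _ _ ENNReal.ofReal_ne_top]
    refine setLIntegral_mono' (isClosed_bigSimplices d x t lam).measurableSet fun X hX => ?_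
    rw [← ENNReal.ofReal_mul (by positivity)]
    exact ENNReal.ofReal_le_ofReal (content_sq_le_mul_cMT_sq ht hlam hX)
  have hd3 : ((d : ℝ≥0∞) + 3) = ENNReal.ofReal (d + 3) := by
    rw [ENNReal.ofReal_add (by positivity) (by norm_num), ENNReal.ofReal_natCast]
    norm_num
  -- all powers of `t` cancel
  have hreal : 1 / (2 * t) ^ 2 * (2 * (1 + 2 ^ d / c) ^ 2 / (c * t ^ d) ^ 2 *
      ((d + 3) * (C * t ^ d) * (2 * t) ^ ((d + 1) * (d + 2)) *
        ((C⁻¹ * (δ * t) ^ d) ^ (d + 2))⁻¹)) = K := by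
    rw [hK, show (d + 1) * (d + 2) = d * (d + 2) + d + 2 by ring, mul_pow 2 t (d * (d + 2) + d + 2),
      pow_add t, pow_add t, pow_mul t, mul_pow δ t, ← mul_assoc C⁻¹, mul_pow (C⁻¹ * δ ^ d)]
    have hQ : (t ^ d) ^ (d + 2) ≠ 0 := by positivity
    have hP : (C⁻¹ * δ ^ d) ^ (d + 2) ≠ 0 := by positivity
    generalize (t ^ d) ^ (d + 2) = Q at *
    generalize (C⁻¹ * δ ^ d) ^ (d + 2) = P at *
    generalize (2 : ℝ) ^ (d * (d + 2) + d + 2) = N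
    generalize (1 + 2 ^ d / c) ^ 2 = M
    have hT : t ^ d ≠ 0 := by positivity
    generalize t ^ d = T at *
    field_simp
    ring
  calc _ ≤ ENNReal.ofReal (1 / (2 * t) ^ 2) *
        (ENNReal.ofReal (2 * (1 + 2 ^ d / c) ^ 2 / (c * t ^ d) ^ 2) *
        (ENNReal.ofReal (d + 3) * ENNReal.ofReal (C * t ^ d) *
          (ENNReal.ofReal ((2 * t) ^ ((d + 1) * (d + 2))) * localCurvature d μ x t lam) *
          ENNReal.ofReal ((C⁻¹ * (δ * t) ^ d) ^ (d + 2))⁻¹)) := by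
        refine (beta2_sq_mul_measure_le ht hfin hL).trans ?_
        refine mul_le_mul_right (hLint.trans (mul_le_mul_right ?_ _)) _
        rw [div_eq_mul_inv, hd3, ENNReal.ofReal_inv_of_pos (by positivity)]
        gcongr
    _ = ENNReal.ofReal K * localCurvature d μ x t lam := by
        rw [← hreal]
        rw [ENNReal.ofReal_mul (p := 1 / (2 * t) ^ 2) (by positivity),
          ENNReal.ofReal_mul (p := 2 * (1 + 2 ^ d / c) ^ 2 / (c * t ^ d) ^ 2) (by positivity),
          ENNReal.ofReal_mul
            (p := (d + 3) * (C * t ^ d) * (2 * t) ^ ((d + 1) * (d + 2))) (by positivity),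
          ENNReal.ofReal_mul (p := (d + 3) * (C * t ^ d)) (by positivity),
          ENNReal.ofReal_mul (p := (d : ℝ) + 3) (by positivity)]
        ring
    _ ≤ _ := mul_le_mul_left (ENNReal.ofReal_le_ofReal (le_max_right _ _)) _

end SingleScaleEstimate

/-! ### The multiscale estimate -/

section MultiScale

variable {H : Type*} [NormedAddCommGroup H] [MeasurableSpace H] [BorelSpace H]
  [SecondCountableTopology H]

lemma measurableSet_wellScaledSimplices (d : ℕ) {A : Set H} (hA : MeasurableSet A) (lam : ℝ) :
    MeasurableSet (wellScaledSimplices d A lam) := by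
  have hD := measurable_simplexDiam (H := H) (d := d)
  simp only [wellScaledSimplices, le_minEdge_iff, Set.ofPred_and, Set.ofPred_forall]
  refine (MeasurableSet.iInter fun i => measurable_pi_apply i hA).inter
    ((MeasurableSet.iInter fun i => MeasurableSet.iInter fun j => MeasurableSet.iInter fun _ =>
      measurableSet_le (hD.const_mul _) ?_).inter (measurableSet_lt measurable_const (hD.const_mul _)))
  exact Continuous.measurable (by fun_prop)

variable [InnerProductSpace ℝ H]

/-- The multiscale estimate follows from the single-scale one by Tonelli's theorem: a given
simplex `X` is only seen at scales `t` between `diam X / 2` and `diam X / lam`, from points `x` at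
distance at most `t` from its vertices. The flatness is the integral of a function that need not be
measurable; it is bounded by a measurable one before integrals are exchanged. -/
theorem jonesFlatness_le_of_single_scale {d : ℕ} {C C₁ lam : ℝ} {μ : Measure H}
    (hμ : IsRegularWith d C μ) (hlam : 0 < lam) (hC₁ : 0 ≤ C₁)
    (hβ : ∀ x ∈ μ.support, ∀ t : ℝ, 0 < t → ENNReal.ofReal t ≤ Metric.ediam μ.support →
      beta2 d μ x t ^ 2 * μ (Metric.closedBall x t) ≤
        ENNReal.ofReal C₁ * localCurvature d μ x t lam)
    (z : H) {r : ℝ} (hr : 0 < r)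
    (hrd : Metric.ediam (Metric.closedBall z r) ≤ Metric.ediam μ.support) :
    jonesFlatness d μ z r ≤ ENNReal.ofReal (C₁ * C ^ 2 * (2 / lam) ^ (d + 1)) *
      wellScaledCurvature d μ (Metric.closedBall z (3 * r)) (lam / 2) := by
  have hC0 : 0 < C := zero_lt_one.trans_le hμ.1
  have hlf : IsLocallyFiniteMeasure μ := hμ.2.1
  set ν := Measure.pi fun _ : Fin (d + 2) => μ with hν
  set R := Metric.diam (Metric.closedBall z r) with hR
  have hR2 : R ≤ 2 * r := Metric.diam_closedBall hr.le
  have hRd : ENNReal.ofReal R ≤ Metric.ediam μ.support := by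
    rw [hR, Metric.diam, ENNReal.ofReal_toReal Metric.isBounded_closedBall.ediam_ne_top]
    exact hrd
  rw [jonesFlatness, ← hR]
  -- if `H` is trivial then `R = 0`
  rcases le_or_gt R 0 with hR0 | hR0
  · simp [Set.Ioc_eq_empty (not_lt.2 hR0)]
  set W := wellScaledSimplices d (Metric.closedBall z (3 * r)) (lam / 2) with hW
  have hWm : MeasurableSet W := measurableSet_wellScaledSimplices d measurableSet_closedBall _
  have hDm := measurable_simplexDiam (H := H) (d := d)
  have hcm := measurable_cMT (H := H) (d := d)
  let q : (Fin (d + 2) → H) → ℝ≥0∞ := W.indicator fun X =>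
    ENNReal.ofReal (cMT X ^ 2) * ENNReal.ofReal ((2 / simplexDiam X) ^ (d + 1))
  have hqm : Measurable q := by
    refine Measurable.indicator ?_ hWm
    fun_prop
  -- the cut-off at `R` keeps the balls `B(X 0, ρ X)` in the range of radii where `μ` is regular
  let ρ : (Fin (d + 2) → H) → ℝ := fun X => min (simplexDiam X / lam) R
  have hρm : Measurable ρ := by fun_prop
  let S : Set (ℝ × (Fin (d + 2) → H)) := {s | s.1 ≤ simplexDiam s.2 / lam}
  have hSm : MeasurableSet S := measurableSet_le (by fun_prop) (by fun_prop)
  let T : Set (H × (Fin (d + 2) → H)) := {s | dist s.1 (s.2 0) ≤ ρ s.2}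
  have hTm : MeasurableSet T := measurableSet_le
    (Continuous.measurable (by fun_prop)) (hρm.comp measurable_snd)
  have hone : ∀ {α : Type _} [MeasurableSpace α] {s : Set α}, MeasurableSet s →
      Measurable (s.indicator (1 : α → ℝ≥0∞)) := fun hs => measurable_one.indicator hs
  have hsupp : ∀ᵐ x ∂μ, x ∈ μ.support := Measure.support_mem_ae
  -- for fixed `X` the domination splits into a factor depending on `x` and one depending on `t`
  have hpt : ∀ x ∈ μ.support, x ∈ Metric.closedBall z r → ∀ t ∈ Set.Ioc 0 R,
      beta2 d μ x t ^ 2 * ENNReal.ofReal (1 / t) ≤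
        ∫⁻ X, ENNReal.ofReal (C₁ * C) *
          (q X * T.indicator 1 (x, X) * S.indicator 1 (t, X)) ∂ν := by
    intro x hx hxz t ht
    have ht0 := ht.1
    have htd : ENNReal.ofReal t ≤ Metric.ediam μ.support :=
      (ENNReal.ofReal_le_ofReal ht.2).trans hRd
    have h1 : beta2 d μ x t ^ 2 * ENNReal.ofReal (C⁻¹ * t ^ d) ≤
        ENNReal.ofReal C₁ * localCurvature d μ x t lam :=
      (mul_le_mul_right (hμ.2.2 x hx t ht0 htd).1 _).trans (hβ x hx t ht0 htd)
    calc beta2 d μ x t ^ 2 * ENNReal.ofReal (1 / t)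
        = beta2 d μ x t ^ 2 * ENNReal.ofReal (C⁻¹ * t ^ d) * ENNReal.ofReal (C / t ^ (d + 1)) := by
          rw [mul_assoc, ← ENNReal.ofReal_mul (by positivity)]
          congr 2
          rw [pow_succ]
          field_simp
      _ ≤ ENNReal.ofReal C₁ * localCurvature d μ x t lam * ENNReal.ofReal (C / t ^ (d + 1)) :=
          mul_le_mul_left h1 _
      _ = ∫⁻ X in bigSimplices d x t lam, ENNReal.ofReal (C₁ * C) *
            (ENNReal.ofReal (cMT X ^ 2) * ENNReal.ofReal (1 / t ^ (d + 1))) ∂ν := by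
          rw [lintegral_const_mul' _ _ ENNReal.ofReal_ne_top,
            lintegral_mul_const' _ _ ENNReal.ofReal_ne_top, localCurvature, ← hν,
            ENNReal.ofReal_mul hC₁, div_eq_mul_one_div C, ENNReal.ofReal_mul hC0.le]
          ring
      _ ≤ ∫⁻ X in bigSimplices d x t lam, ENNReal.ofReal (C₁ * C) *
            (q X * T.indicator 1 (x, X) * S.indicator 1 (t, X)) ∂ν := by
          refine setLIntegral_mono' (isClosed_bigSimplices d x t lam).measurableSet fun X hX => ?_
          obtain ⟨hXB, hXmin⟩ := hX
          have hlt : 0 < lam * t := by positivity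
          have hDpos : 0 < simplexDiam X := hlt.trans_le (hXmin.trans (minEdge_le_simplexDiam X))
          have hD2t : simplexDiam X ≤ 2 * t :=
            (simplexDiam_le_iff (by positivity)).2 (dist_le_two_mul hXB)
          have htD : t ≤ simplexDiam X / lam := by
            rw [le_div_iff₀ hlam, mul_comm]
            exact hXmin.trans (minEdge_le_simplexDiam X)
          have hXW : X ∈ W := by
            refine ⟨fun i => ?_, ?_, by positivity⟩
            · have h2 := Metric.mem_closedBall.1 (hXB i)
              have h3 := Metric.mem_closedBall.1 hxz
              rw [Metric.mem_closedBall]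
              linarith [dist_triangle (X i) x z, ht.2]
            · refine le_trans ?_ hXmin
              calc lam / 2 * simplexDiam X ≤ lam / 2 * (2 * t) := by gcongr
                _ = lam * t := by ring
          have hXT : (x, X) ∈ T := by
            have h2 := Metric.mem_closedBall'.1 (hXB 0)
            exact le_min (h2.trans htD) (h2.trans ht.2)
          have hXS : (t, X) ∈ S := htD
          simp only [q, Set.indicator_of_mem hXW, Set.indicator_of_mem hXT,
            Set.indicator_of_mem hXS, Pi.one_apply, mul_one]
          gcongr
          rw [div_pow, one_div, ← inv_div, ← div_pow]
          gcongr
          linarith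
      _ ≤ _ := setLIntegral_le_lintegral _ _
  calc _ ≤ ∫⁻ x in Metric.closedBall z r, (∫⁻ t in Set.Ioc 0 R,
        ∫⁻ X, ENNReal.ofReal (C₁ * C) *
          (q X * T.indicator 1 (x, X) * S.indicator 1 (t, X)) ∂ν) ∂μ := by
        refine lintegral_mono_ae ?_
        filter_upwards [ae_restrict_mem measurableSet_closedBall, ae_restrict_of_ae hsupp]
          with x hxz hx
        exact setLIntegral_mono' measurableSet_Ioc fun t ht => hpt x hx hxz t ht
    _ ≤ ∫⁻ x in Metric.closedBall z r, (∫⁻ X, ENNReal.ofReal (C₁ * C) *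
          (q X * T.indicator 1 (x, X) * ENNReal.ofReal (simplexDiam X / lam)) ∂ν) ∂μ := by
        refine lintegral_mono fun x => ?_
        rw [lintegral_lintegral_swap]
        · refine lintegral_mono fun X => ?_
          rw [lintegral_const_mul' _ _ ENNReal.ofReal_ne_top, lintegral_const_mul]
          · gcongr
            have : ∀ t, S.indicator (1 : ℝ × (Fin (d + 2) → H) → ℝ≥0∞) (t, X) =
                (Set.Iic (simplexDiam X / lam)).indicator 1 t := fun t => rfl
            simp only [this]
            rw [lintegral_indicator_one measurableSet_Iic, Measure.restrict_apply measurableSet_Iic,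
              Set.inter_comm, Set.Ioc_inter_Iic, Real.volume_Ioc, sub_zero]
            exact ENNReal.ofReal_le_ofReal (min_le_right _ _)
          · exact (hone hSm).comp measurable_prodMk_right
        · refine Measurable.aemeasurable (Measurable.const_mul (Measurable.mul ?_ ?_) _)
          · exact (hqm.mul ((hone hTm).comp measurable_prodMk_left)).comp measurable_snd
          · exact hone hSm
    _ ≤ ∫⁻ X, ENNReal.ofReal (C₁ * C) * (q X * μ (Metric.closedBall (X 0) (ρ X)) *
          ENNReal.ofReal (simplexDiam X / lam)) ∂ν := by
        rw [lintegral_lintegral_swap]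
        · refine lintegral_mono fun X => ?_
          have hTX : ∀ x, T.indicator (1 : H × (Fin (d + 2) → H) → ℝ≥0∞) (x, X) =
              (Metric.closedBall (X 0) (ρ X)).indicator 1 x := fun x => rfl
          simp only [hTX]
          rw [lintegral_const_mul' _ _ ENNReal.ofReal_ne_top,
            lintegral_mul_const' _ _ ENNReal.ofReal_ne_top,
            lintegral_const_mul _ (hone measurableSet_closedBall),
            lintegral_indicator_one measurableSet_closedBall]
          gcongr
          exact Measure.restrict_le_self
        · refine Measurable.aemeasurable (Measurable.const_mul (Measurable.mul ?_ ?_) _)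
          · exact (hqm.comp measurable_snd).mul (hone hTm)
          · fun_prop
    _ ≤ ∫⁻ X, ENNReal.ofReal (C₁ * C ^ 2 * (2 / lam) ^ (d + 1)) *
          W.indicator (fun X => ENNReal.ofReal (cMT X ^ 2)) X ∂ν := by
        refine lintegral_mono_ae ?_
        have hX0 : ∀ᵐ X ∂ν, X 0 ∈ μ.support :=
          (Measure.tendsto_eval_ae_ae (μ := fun _ : Fin (d + 2) => μ) (i := 0)).eventually hsupp
        filter_upwards [hX0] with X hX0
        by_cases hXW : X ∈ W
        · have hD : 0 < simplexDiam X := by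
            have := hXW.2.2
            exact pos_of_mul_pos_right this (by positivity)
          have hρ0 : 0 < ρ X := lt_min (by positivity) hR0
          have hball : μ (Metric.closedBall (X 0) (ρ X)) ≤
              ENNReal.ofReal (C * (simplexDiam X / lam) ^ d) := by
            refine (hμ.2.2 (X 0) hX0 (ρ X) hρ0
              ((ENNReal.ofReal_le_ofReal (min_le_right _ _)).trans hRd)).2.trans ?_
            refine ENNReal.ofReal_le_ofReal ?_
            gcongr
            exact min_le_left _ _
          simp only [q, Set.indicator_of_mem hXW]
          calc _ ≤ ENNReal.ofReal (C₁ * C) * (ENNReal.ofReal (cMT X ^ 2) *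
                ENNReal.ofReal ((2 / simplexDiam X) ^ (d + 1)) *
                ENNReal.ofReal (C * (simplexDiam X / lam) ^ d) *
                ENNReal.ofReal (simplexDiam X / lam)) := by gcongr
            _ = _ := by
                rw [← ENNReal.ofReal_mul (by positivity), ← ENNReal.ofReal_mul (by positivity),
                  ← ENNReal.ofReal_mul (by positivity), ← ENNReal.ofReal_mul (by positivity),
                  ← ENNReal.ofReal_mul (by positivity)]
                congr 1
                rw [div_pow, div_pow, div_pow, pow_succ, pow_succ, pow_succ]
                field_simp
                ring
        · simp [q, Set.indicator_of_notMem hXW]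
    _ = _ := by
        rw [lintegral_const_mul' _ _ ENNReal.ofReal_ne_top, lintegral_indicator hWm]
        rfl

end MultiScale

end MengerCurvature

end

theorem theorem1p4 (d : ℕ) (hd : 1 ≤ d) (C : ℝ) (hC : 1 ≤ C) :
    ∃ lam₀ C₁ C₃ : ℝ, 0 < lam₀ ∧ lam₀ < 2 ∧ 1 ≤ C₁ ∧ 1 ≤ C₃ ∧
      ∀ (H : Type*) [NormedAddCommGroup H] [InnerProductSpace ℝ H] [CompleteSpace H]
        [TopologicalSpace.SeparableSpace H] [MeasurableSpace H] [BorelSpace H]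
        (μ : Measure H),
        (d : Cardinal) < Module.rank ℝ H →
        MengerCurvature.IsRegularWith d C μ →
        -- `lam₀` is a constant for the single-scale estimate
        (∀ x ∈ μ.support, ∀ t : ℝ, 0 < t → ENNReal.ofReal t ≤ Metric.ediam μ.support →
          MengerCurvature.beta2 d μ x t ^ 2 * μ (Metric.closedBall x t) ≤
            ENNReal.ofReal C₁ * MengerCurvature.localCurvature d μ x t lam₀) ∧
        -- the multiscale estimate, with the same `lam₀`
        (∀ (z : H) (r : ℝ), 0 < r →
          Metric.ediam (Metric.closedBall z r) ≤ Metric.ediam μ.support →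
          MengerCurvature.jonesFlatness d μ z r ≤
            ENNReal.ofReal C₃ *
              MengerCurvature.wellScaledCurvature d μ (Metric.closedBall z (3 * r)) (lam₀ / 2)) := by
  obtain ⟨lam, C₁, hlam, hlam2, hC₁, hβ⟩ := MengerCurvature.exists_beta2_sq_mul_le hd hC
  refine ⟨lam, C₁, max 1 (C₁ * C ^ 2 * (2 / lam) ^ (d + 1)), hlam, hlam2, hC₁, le_max_left _ _, ?_⟩
  intro H _ _ _ _ _ _ μ _ hμ
  have : SecondCountableTopology H := UniformSpace.secondCountable_of_separable H
  refine ⟨hβ H μ hμ, fun z r hr hrd => ?_⟩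
  exact (MengerCurvature.jonesFlatness_le_of_single_scale hμ hlam (zero_le_one.trans hC₁)
    (hβ H μ hμ) z hr hrd).trans
    (mul_le_mul_left (ENNReal.ofReal_le_ofReal (le_max_right _ _)) _)
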